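/- **Lemma 3.4 (thermodynamic limit for the Dirichlet energy in a square).** For a bounded open set $\Omega\subset\mathbb R^2$, $\beta\ge 0$ and $M\ge 0$ let $$E_0(\Omega,\beta,M):=\inf\Big\{\int_\Omega\big|(-i\nabla+\beta\,\mathbf A[|u|^2])u\big|^2 \;:\; u\in H^1_0(\Omega;\mathbb C),\ \int_\Omega|u|^2=M\Big\},$$ where $$\mathbf A[\varrho](\mathbf x):=\int_\Omega \nabla^\perp w_0(\mathbf x-\mathbf y)\,\varrho(\mathbf y)\,\mathrm d\mathbf y,\qquad w_0(\mathbf x):=\log|\mathbf x|,\qquad \nabla^\perp=(-\partial_2,\partial_1).$$ Let $Q\subset\mathbb R^2$ be an (open) unit square, in any position and orientation, and let $\beta\ge 0$ and $\rho\ge 0$ be fixed. Then the limit $$e(\beta,\rho)=\lim_{L\to+\infty}\frac{E_0(LQ,\beta,\rho L^2)}{L^2}$$ exists, is finite, does not depend on the choice of the unit square $Q$, and satisfies $e(\beta,\rho)\ge 2\pi\beta\rho^2$. In particular $e(1,1)\ge 2\pi$. -/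

import Mathlib

open MeasureTheory Filter Topology
open scoped ENNReal Pointwise ContDiff

namespace AnyonGas

/-- The Euclidean plane `ℝ²`. -/
abbrev Plane : Type := EuclideanSpace ℝ (Fin 2)

/-- The partial derivative `∂_j f (x)` (real or complex valued `f`). -/
noncomputable def pderiv {F : Type*} [NormedAddCommGroup F] [NormedSpace ℝ F]
    (j : Fin 2) (f : Plane → F) (x : Plane) : F :=
  fderiv ℝ f x (EuclideanSpace.single j 1)

/-- The rotated gradient `∇^⊥ f = (-∂_2 f, ∂_1 f)`. -/
noncomputable def perpGrad (f : Plane → ℝ) (x : Plane) : Plane :=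
  !₂[-pderiv 1 f x, pderiv 0 f x]

/-- The two-dimensional Coulomb potential `w₀(x) = log |x|`. -/
noncomputable def w0 (x : Plane) : ℝ := Real.log ‖x‖

/-- `∇^⊥ w₀ (x) = x^⊥ / |x|²` with `(x₁, x₂)^⊥ = (-x₂, x₁)`; at the single point `x = 0`,
where `w₀` is singular, both sides of this Lean identity are `0`. -/
theorem perpGrad_w0 (x : Plane) : perpGrad w0 x = (‖x‖ ^ 2)⁻¹ • !₂[-x 1, x 0] := by
  by_cases hx : x = 0
  · subst hx
    have hnd : ¬ DifferentiableAt ℝ w0 (0 : Plane) := by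
      intro h
      have h1 : DifferentiableAt ℝ
          (fun t : ℝ => w0 (t • (EuclideanSpace.single 0 1 : Plane))) 0 := by
        have h0 : DifferentiableAt ℝ w0 ((0 : ℝ) • (EuclideanSpace.single 0 1 : Plane)) := by
          simpa using h
        have hs : DifferentiableAt ℝ
            (fun t : ℝ => t • (EuclideanSpace.single 0 1 : Plane)) 0 := by fun_prop
        exact DifferentiableAt.comp (g := w0) (0 : ℝ) h0 hs
      have h2 : (fun t : ℝ => w0 (t • (EuclideanSpace.single 0 1 : Plane))) = Real.log := by
        funext t
        simp [w0, norm_smul, Real.log_abs]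
      rw [h2] at h1
      exact Real.differentiableAt_log_iff.1 h1 rfl
    ext i
    fin_cases i <;> simp [perpGrad, pderiv, fderiv_zero_of_not_differentiableAt hnd]
  · have hsq : HasFDerivAt (fun y : Plane => ‖y‖ ^ 2) (2 • innerSL ℝ x) x :=
      (hasStrictFDerivAt_norm_sq x).hasFDerivAt
    have hne : ‖x‖ ^ 2 ≠ 0 := by positivity
    have hw : w0 = fun y : Plane => (1 / 2 : ℝ) * Real.log (‖y‖ ^ 2) := by
      funext y
      simp [w0, Real.log_pow]
    have hd : HasFDerivAt w0 ((1 / 2 : ℝ) • ((‖x‖ ^ 2)⁻¹ • (2 • innerSL ℝ x))) x := by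
      rw [hw]
      exact (hsq.log hne).const_mul _
    ext i
    fin_cases i <;>
      simp [perpGrad, pderiv, hd.fderiv, EuclideanSpace.inner_single_right] <;> ring

/-- The self-generated vector potential on a domain,
`A[ϱ](x) = ∫_Ω ∇^⊥ w₀ (x - y) ϱ(y) dy`. -/
noncomputable def vectorPotential (Ω : Set Plane) (ϱ : Plane → ℝ) (x : Plane) : Plane :=
  ∫ y in Ω, ϱ y • perpGrad w0 (x - y)

/-- The class `C_c^∞(Ω; ℂ)`. -/
def IsTestFunction (Ω : Set Plane) (φ : Plane → ℂ) : Prop :=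
  ContDiff ℝ ∞ φ ∧ HasCompactSupport φ ∧ tsupport φ ⊆ Ω

/-- `u ∈ H¹(Ω; ℂ)` and its weak gradient on `Ω` is `g = (g 0, g 1)`. -/
structure IsH1 (Ω : Set Plane) (u : Plane → ℂ) (g : Fin 2 → Plane → ℂ) : Prop where
  memLp : MemLp u 2 (volume.restrict Ω)
  memLp_grad : ∀ j, MemLp (g j) 2 (volume.restrict Ω)
  weak_grad : ∀ φ : Plane → ℂ, IsTestFunction Ω φ →
    ∀ j, ∫ x in Ω, u x * pderiv j φ x = -∫ x in Ω, g j x * φ x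

/-- `u ∈ H¹₀(Ω; ℂ)`, the closure of `C_c^∞(Ω; ℂ)` in `H¹(Ω; ℂ)`, and its weak gradient is `g`
(which is determined by `u` almost everywhere on the open set `Ω`). -/
structure IsH10 (Ω : Set Plane) (u : Plane → ℂ) (g : Fin 2 → Plane → ℂ) : Prop
    extends IsH1 Ω u g where
  approx : ∃ φ : ℕ → Plane → ℂ, (∀ n, IsTestFunction Ω (φ n)) ∧
    Tendsto (fun n => eLpNorm (fun x => φ n x - u x) 2 (volume.restrict Ω)) atTop (𝓝 0) ∧
    ∀ j, Tendsto (fun n => eLpNorm (fun x => pderiv j (φ n) x - g j x) 2 (volume.restrict Ω))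
      atTop (𝓝 0)

/-- The average-field energy `∫_Ω |(-i∇ + β A[|u|²]) u|²` of a function `u` with weak gradient `g`.
It is a Lebesgue integral of a non-negative function, valued in `[0, ∞]`. -/
noncomputable def afEnergy (Ω : Set Plane) (β : ℝ) (u : Plane → ℂ) (g : Fin 2 → Plane → ℂ) :
    ℝ≥0∞ :=
  ∫⁻ x in Ω, ENNReal.ofReal (∑ j : Fin 2,
    ‖-Complex.I * g j x
      + ((β * vectorPotential Ω (fun y => ‖u y‖ ^ 2) x j : ℝ) : ℂ) * u x‖ ^ 2)

/-- The Dirichlet energy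
`E₀(Ω, β, M) = inf { ∫_Ω |(-i∇ + β A[|u|²]) u|² : u ∈ H¹₀(Ω), ∫_Ω |u|² = M }`, valued in `[0, ∞]`
(with `inf ∅ = ∞`). -/
noncomputable def dirichletEnergy (Ω : Set Plane) (β M : ℝ) : ℝ≥0∞ :=
  sInf {ε : ℝ≥0∞ | ∃ (u : Plane → ℂ) (g : Fin 2 → Plane → ℂ),
    IsH10 Ω u g ∧ ∫ x in Ω, ‖u x‖ ^ 2 = M ∧ ε = afEnergy Ω β u g}

/-- `Q` is an open square with side length one, in any position:
the image of `(0,1)²` under a Euclidean isometry. -/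
def IsUnitSquare (Q : Set Plane) : Prop :=
  ∃ f : Plane ≃ᵃⁱ[ℝ] Plane, Q = f '' {x : Plane | ∀ i, 0 < x i ∧ x i < 1}

end AnyonGas

/-! Everything reduces to one function of one variable. Let `unitEnergy b` be the infimum of the
energy with coupling `b` over smooth, compactly supported states of mass one in the open unit
square. The energy is covariant under similarities and amplitude scaling, so for `ρ, L > 0` the
Dirichlet energy of `L • Q` with mass `ρ L²` equals `ρ * unitEnergy (β ρ L²)`
(`dirichletEnergy_eq`). Reflections reverse the sign of `β`, and complex conjugation restores it, so
neither position nor orientation of `Q` matters. The claim becomes the convergence of `unitEnergy b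
/ b` as `b → ∞`; for `β, ρ ≥ 0` the limit is `β ρ²` times that of `unitEnergy b / b`.

Convergence comes from exact subadditivity. The potential `A` is long ranged, but away from its
source it is a gradient: `∇^⊥ log |x|` is the gradient of the polar angle. For states separated by a
line a single branch of the angle suffices, so each state's potential acting on the other is removed
by a smooth phase, and energies simply add (`exists_glue`). Tiling by `n²` copies gives `unitEnergy
(n² b) ≤ n² * unitEnergy b`; continuity in the coupling for a fixed state handles values between the
`n² b`, and `unitEnergy b / b` tends to its infimum (`tendsto_unitEnergy_div`).

The lower bound is the magnetic one: expanding `|D₀u - i D₁u|² ≥ 0`, where `D_j` are the magnetic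
derivatives, and using `curl A[|u|²] = 2π|u|²` gives energy at least `2πβ ∫|u|⁴` (`le_magEnergy`),
which is at least `2πβ` for mass one on area one.

Passing from `H¹₀` to test functions uses the Sobolev embedding into `L⁶`: it makes `|u|²` converge
in `L³`, and the kernel is locally in the dual space `L^{3/2}`, so the potentials converge uniformly
on bounded sets (`IsH10.exists_approx`). -/

namespace AnyonGas

/-! ### The kernel and bounds on the vector potential. -/

theorem norm_perpGrad_w0 (x : Plane) : ‖perpGrad w0 x‖ = ‖x‖⁻¹ := by
  have h : ‖(!₂[-x 1, x 0] : Plane)‖ = ‖x‖ := by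
    simp [EuclideanSpace.norm_eq, Fin.sum_univ_two, add_comm]
  rw [perpGrad_w0, norm_smul, h, norm_inv, norm_pow, norm_norm]
  by_cases hx : ‖x‖ = 0
  · simp [hx]
  · field_simp

theorem perpGrad_w0_apply_zero (x : Plane) : perpGrad w0 x 0 = -x 1 / ‖x‖ ^ 2 := by
  rw [perpGrad_w0]; simp; ring

theorem perpGrad_w0_apply_one (x : Plane) : perpGrad w0 x 1 = x 0 / ‖x‖ ^ 2 := by
  rw [perpGrad_w0]; simp; ring

theorem measurable_perpGrad_w0 : Measurable (perpGrad w0) := by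
  have h : perpGrad w0 = fun x : Plane => (‖x‖ ^ 2)⁻¹ • (!₂[-x 1, x 0] : Plane) :=
    funext perpGrad_w0
  rw [h]
  have : Continuous fun x : Plane => (!₂[-x 1, x 0] : Plane) := by
    refine (PiLp.continuous_toLp 2 _).comp (continuous_pi fun i => ?_)
    fin_cases i <;> simp <;> fun_prop
  exact (measurable_norm.pow_const 2).inv.smul this.measurable

/-- The `L^{3/2}` norm of the kernel on a ball of radius `2 R`. -/
noncomputable def kernelBound (R : ℝ) : ℝ≥0∞ :=
  eLpNorm (perpGrad w0) (3 / 2) (volume.restrict (Metric.ball 0 (2 * R)))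

theorem finrank_plane : Module.finrank ℝ Plane = 2 := by simp

theorem threeHalves_toReal : ((3 / 2 : ℝ≥0∞)).toReal = 3 / 2 := by
  rw [ENNReal.toReal_div]; norm_num

/-- The kernel has modulus `1 / |z|`, and `|z|^{-3/2}` is locally integrable in dimension two. The
exponent `3/2` is dual to `3`, the integrability of `|u|²` for `u ∈ L⁶`. -/
theorem kernelBound_lt_top (R : ℝ) : kernelBound R < ⊤ := by
  have h0 : (3 / 2 : ℝ≥0∞) ≠ 0 := by simp
  have h1 : (3 / 2 : ℝ≥0∞) ≠ ⊤ := by finiteness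
  have hm : AEStronglyMeasurable (perpGrad w0) (volume.restrict (Metric.ball 0 (2 * R))) :=
    measurable_perpGrad_w0.aestronglyMeasurable
  have := (integrable_norm_rpow_iff hm h0 h1).1 ?_
  · exact this.2
  rw [threeHalves_toReal]
  refine integrableOn_ball_of_norm_le_rpow (C := 1) (α := 3 / 2) ?_ ?_ ?_ ?_
  · simp
  · rw [finrank_plane]; norm_num
  · refine Eventually.of_forall fun x => ?_
    rw [norm_perpGrad_w0, Real.norm_of_nonneg (by positivity), one_mul,
      Real.inv_rpow (norm_nonneg _), Real.rpow_neg (norm_nonneg _)]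
  · exact (measurable_perpGrad_w0.norm.pow_const _).aestronglyMeasurable

/-- Differences of points of the ball of radius `R` lie in the ball of radius `2 R`, so the bound is
uniform in `x`. -/
theorem eLpNorm_kernel_translate_le {R : ℝ} {Ω : Set Plane} (hΩ : Ω ⊆ Metric.ball 0 R)
    {x : Plane} (hx : x ∈ Metric.ball 0 R) :
    eLpNorm (fun y => perpGrad w0 (x - y)) (3 / 2) (volume.restrict Ω) ≤ kernelBound R := by
  have hp := (Measure.measurePreserving_sub_left (volume : Measure Plane) x).restrict_preimage
    (s := Metric.ball 0 (2 * R)) Metric.isOpen_ball.measurableSet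
  have hsub : Ω ⊆ (fun y => x - y) ⁻¹' Metric.ball 0 (2 * R) := by
    intro y hy
    have h1 := hΩ hy
    simp only [Metric.mem_ball, dist_zero_right, Set.mem_preimage] at *
    linarith [norm_sub_le x y]
  refine (eLpNorm_mono_measure _ (Measure.restrict_mono hsub le_rfl)).trans ?_
  exact (eLpNorm_comp_measurePreserving
    measurable_perpGrad_w0.aestronglyMeasurable hp).le

instance holderTriple_three : ENNReal.HolderTriple 3 (3 / 2) 1 := by
  constructor
  rw [ENNReal.inv_div (by simp) (by simp), ← ENNReal.toReal_eq_toReal_iff' (by simp; finiteness)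
    (by simp)]
  rw [ENNReal.toReal_add (by simp) (by finiteness), ENNReal.toReal_div, ENNReal.toReal_inv]
  norm_num

theorem eLpNorm_kernel_smul_le {R : ℝ} {Ω : Set Plane} (hΩ : Ω ⊆ Metric.ball 0 R)
    {x : Plane} (hx : x ∈ Metric.ball 0 R) {σ : Plane → ℝ}
    (hσ : AEStronglyMeasurable σ (volume.restrict Ω)) :
    eLpNorm (fun y => σ y • perpGrad w0 (x - y)) 1 (volume.restrict Ω) ≤
      eLpNorm σ 3 (volume.restrict Ω) * kernelBound R :=
  (eLpNorm_smul_le_mul_eLpNorm (p := 3) (q := 3 / 2)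
    (measurable_perpGrad_w0.comp (measurable_const.sub measurable_id)).aestronglyMeasurable
    hσ).trans (mul_le_mul_right (eLpNorm_kernel_translate_le hΩ hx) _)

theorem integrable_kernel_smul {R : ℝ} {Ω : Set Plane} (hΩ : Ω ⊆ Metric.ball 0 R)
    {x : Plane} (hx : x ∈ Metric.ball 0 R) {σ : Plane → ℝ} (hσ : MemLp σ 3 (volume.restrict Ω)) :
    Integrable (fun y => σ y • perpGrad w0 (x - y)) (volume.restrict Ω) := by
  rw [← memLp_one_iff_integrable]
  exact ⟨hσ.1.smul
    (measurable_perpGrad_w0.comp (measurable_const.sub measurable_id)).aestronglyMeasurable,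
    (eLpNorm_kernel_smul_le hΩ hx hσ.1).trans_lt (ENNReal.mul_lt_top hσ.2 (kernelBound_lt_top R))⟩

theorem enorm_vectorPotential_le {R : ℝ} {Ω : Set Plane} (hΩ : Ω ⊆ Metric.ball 0 R)
    {x : Plane} (hx : x ∈ Metric.ball 0 R) {σ : Plane → ℝ}
    (hσ : AEStronglyMeasurable σ (volume.restrict Ω)) :
    ‖vectorPotential Ω σ x‖ₑ ≤ eLpNorm σ 3 (volume.restrict Ω) * kernelBound R := by
  refine (enorm_integral_le_lintegral_enorm _).trans ?_
  rw [← eLpNorm_one_eq_lintegral_enorm]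
  exact eLpNorm_kernel_smul_le hΩ hx hσ

theorem aestronglyMeasurable_vectorPotential {Ω : Set Plane} {σ : Plane → ℝ}
    (hσ : AEStronglyMeasurable σ (volume.restrict Ω)) :
    AEStronglyMeasurable (vectorPotential Ω σ) volume := by
  have : AEStronglyMeasurable (fun p : Plane × Plane => σ p.2 • perpGrad w0 (p.1 - p.2))
      (volume.prod (volume.restrict Ω)) :=
    hσ.comp_snd.smul
      (measurable_perpGrad_w0.comp (measurable_fst.sub measurable_snd)).aestronglyMeasurable
  exact this.integral_prod_right'

theorem vectorPotential_apply {Ω : Set Plane} {σ : Plane → ℝ} {x : Plane}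
    (h : Integrable (fun y => σ y • perpGrad w0 (x - y)) (volume.restrict Ω)) (j : Fin 2) :
    vectorPotential Ω σ x j = ∫ y in Ω, σ y * perpGrad w0 (x - y) j :=
  ((EuclideanSpace.proj (𝕜 := ℝ) j).integral_comp_comm h).symm

theorem vectorPotential_eq_univ {Ω : Set Plane} {σ : Plane → ℝ} (h : ∀ y ∉ Ω, σ y = 0) :
    vectorPotential Ω σ = vectorPotential Set.univ σ := by
  funext x
  simp only [vectorPotential, Measure.restrict_univ]
  exact setIntegral_eq_integral_of_forall_compl_eq_zero fun y hy => by simp [h y hy]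

/-! ### Smooth trial states and their energy on the whole plane. -/

theorem pderiv_apply_eq {F : Type*} [NormedAddCommGroup F] [NormedSpace ℝ F]
    {f : Plane → F} {x : Plane} {f' : Plane →L[ℝ] F} (h : HasFDerivAt f f' x) (j : Fin 2) :
    pderiv j f x = f' (EuclideanSpace.single j 1) := by
  rw [pderiv, h.fderiv]

/-- The magnetic derivative `(-i ∂_j + β A_j[|u|²]) u` on the whole plane. -/
noncomputable def magField (β : ℝ) (u : Plane → ℂ) (j : Fin 2) (x : Plane) : ℂ :=
  -Complex.I * pderiv j u x
    + ((β * vectorPotential Set.univ (fun y => ‖u y‖ ^ 2) x j : ℝ) : ℂ) * u x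

/-- The average-field energy of `u` on the whole plane. -/
noncomputable def magEnergy (β : ℝ) (u : Plane → ℂ) : ℝ :=
  ∫ x, ∑ j : Fin 2, ‖magField β u j x‖ ^ 2

theorem contDiff_pderiv {F : Type*} [NormedAddCommGroup F] [NormedSpace ℝ F]
    {f : Plane → F} (h : ContDiff ℝ ∞ f) (j : Fin 2) : ContDiff ℝ ∞ (pderiv j f) :=
  (h.fderiv_right (m := ∞) (by simp)).clm_apply contDiff_const

theorem support_pderiv_subset {F : Type*} [NormedAddCommGroup F] [NormedSpace ℝ F]
    (f : Plane → F) (j : Fin 2) : Function.support (pderiv j f) ⊆ tsupport f := by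
  refine Set.Subset.trans ?_ (support_fderiv_subset ℝ (f := f))
  intro x hx h0
  exact hx (by simp [pderiv, h0])

theorem hasCompactSupport_pderiv {F : Type*} [NormedAddCommGroup F] [NormedSpace ℝ F]
    {f : Plane → F} (h : HasCompactSupport f) (j : Fin 2) : HasCompactSupport (pderiv j f) :=
  HasCompactSupport.of_support_subset_isCompact h (support_pderiv_subset f j)

namespace IsTestFunction

variable {Ω : Set Plane} {u : Plane → ℂ}

theorem mono {Ω' : Set Plane} (hu : IsTestFunction Ω u) (h : Ω ⊆ Ω') : IsTestFunction Ω' u :=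
  ⟨hu.1, hu.2.1, hu.2.2.trans h⟩

theorem eq_zero (hu : IsTestFunction Ω u) {x : Plane} (hx : x ∉ Ω) : u x = 0 :=
  image_eq_zero_of_notMem_tsupport fun h => hx (hu.2.2 h)

theorem pderiv (hu : IsTestFunction Ω u) (j : Fin 2) : IsTestFunction Ω (pderiv j u) :=
  ⟨contDiff_pderiv hu.1 j, hasCompactSupport_pderiv hu.2.1 j,
    (closure_minimal (support_pderiv_subset u j) (isClosed_tsupport u)).trans hu.2.2⟩

theorem memLp (hu : IsTestFunction Ω u) (p : ℝ≥0∞) : MemLp u p volume :=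
  hu.1.continuous.memLp_of_hasCompactSupport hu.2.1

theorem normSq (hu : IsTestFunction Ω u) :
    ContDiff ℝ ∞ (fun x => ‖u x‖ ^ 2) ∧ HasCompactSupport (fun x => ‖u x‖ ^ 2) :=
  ⟨hu.1.norm_sq ℝ, hu.2.1.comp_left (g := fun z : ℂ => ‖z‖ ^ 2) (by simp)⟩

theorem memLp_normSq (hu : IsTestFunction Ω u) (p : ℝ≥0∞) : MemLp (fun x => ‖u x‖ ^ 2) p volume :=
  hu.normSq.1.continuous.memLp_of_hasCompactSupport hu.normSq.2

theorem exists_ball (hu : IsTestFunction Ω u) : ∃ R, 0 < R ∧ tsupport u ⊆ Metric.ball 0 R := by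
  obtain ⟨R, hR⟩ := (hu.2.1.isBounded).subset_ball 0
  exact ⟨max R 1, by positivity, hR.trans (Metric.ball_subset_ball (le_max_left _ _))⟩

theorem vectorPotential_ball {R : ℝ} (hR : tsupport u ⊆ Metric.ball 0 R) :
    vectorPotential Set.univ (fun y => ‖u y‖ ^ 2)
      = vectorPotential (Metric.ball 0 R) (fun y => ‖u y‖ ^ 2) := by
  refine (vectorPotential_eq_univ fun y hy => ?_).symm
  simp [image_eq_zero_of_notMem_tsupport fun h => hy (hR h)]

theorem integrable_kernel (hu : IsTestFunction Ω u) (x : Plane) :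
    Integrable (fun y => ‖u y‖ ^ 2 • perpGrad w0 (x - y)) volume := by
  obtain ⟨R, hR0, hR⟩ := hu.exists_ball
  -- The kernel bound needs `x` itself in the ball, hence the enlarged radius.
  have hsub : tsupport u ⊆ Metric.ball 0 (max R (‖x‖ + 1)) :=
    hR.trans (Metric.ball_subset_ball (le_max_left _ _))
  have := integrable_kernel_smul (R := max R (‖x‖ + 1)) subset_rfl (x := x)
    (by simp) ((hu.memLp_normSq 3).restrict _)
  refine (integrableOn_iff_integrable_of_support_subset ?_).1 this
  intro y hy
  refine hsub (subset_tsupport _ fun h0 => hy ?_)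
  simp [h0]

theorem memLp_potential_mul (hu : IsTestFunction Ω u) (j : Fin 2) :
    MemLp (fun x => ((vectorPotential Set.univ (fun y => ‖u y‖ ^ 2) x j : ℝ) : ℂ) * u x) 2
      volume := by
  obtain ⟨R, hR0, hR⟩ := hu.exists_ball
  have hm : AEStronglyMeasurable (fun x => vectorPotential Set.univ (fun y => ‖u y‖ ^ 2) x j)
      volume := by
    have := aestronglyMeasurable_vectorPotential (Ω := Set.univ) (σ := fun y => ‖u y‖ ^ 2)
      (hu.memLp_normSq 3).1.restrict
    exact (EuclideanSpace.proj (𝕜 := ℝ) j).continuous.comp_aestronglyMeasurable this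
  have hC : eLpNorm (fun y => ‖u y‖ ^ 2) 3 (volume.restrict (Metric.ball 0 R)) * kernelBound R
      ≠ ⊤ := (ENNReal.mul_lt_top ((hu.memLp_normSq 3).restrict _).2 (kernelBound_lt_top R)).ne
  refine (hu.memLp 2).of_le_mul (c := (eLpNorm (fun y => ‖u y‖ ^ 2) 3
    (volume.restrict (Metric.ball 0 R)) * kernelBound R).toReal)
    ((Complex.continuous_ofReal.comp_aestronglyMeasurable hm).mul (hu.memLp 2).1)
    (Eventually.of_forall fun x => ?_)
  rw [norm_mul]
  by_cases hx : x ∈ tsupport u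
  · refine mul_le_mul_of_nonneg_right ?_ (norm_nonneg _)
    rw [Complex.norm_real, vectorPotential_ball hR]
    refine (PiLp.norm_apply_le _ j).trans ?_
    have := enorm_vectorPotential_le (R := R) subset_rfl (hR hx) (σ := fun y => ‖u y‖ ^ 2)
      (hu.memLp_normSq 3).1.restrict
    rw [← toReal_enorm]
    exact ENNReal.toReal_mono hC this
  · simp [image_eq_zero_of_notMem_tsupport hx]

theorem memLp_magField (hu : IsTestFunction Ω u) (β : ℝ) (j : Fin 2) :
    MemLp (magField β u j) 2 volume := by
  have h := (((hu.pderiv j).memLp 2).const_mul (-Complex.I)).add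
    ((hu.memLp_potential_mul j).const_mul (β : ℂ))
  refine h.congr_norm ?_ ?_
  · refine h.1.congr (Eventually.of_forall fun x => ?_)
    simp [magField, mul_assoc]
  · refine Eventually.of_forall fun x => ?_
    simp [magField, mul_assoc]

theorem integrable_magField_sq (hu : IsTestFunction Ω u) (β : ℝ) (j : Fin 2) :
    Integrable (fun x => ‖magField β u j x‖ ^ 2) volume :=
  (memLp_two_iff_integrable_sq_norm (hu.memLp_magField β j).1).1 (hu.memLp_magField β j)

theorem integrable_density (hu : IsTestFunction Ω u) (β : ℝ) :
    Integrable (fun x => ∑ j : Fin 2, ‖magField β u j x‖ ^ 2) volume :=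
  integrable_finsetSum _ fun j _ => hu.integrable_magField_sq β j

/-- For fixed `u` the energy is a quadratic polynomial in `β`. It is written through its values at
`0` and `1` and its leading coefficient: `|X + βY|² = (1-β)|X|² + β|X+Y|² + (β²-β)|Y|²`. This avoids
integrating the cross term separately. -/
theorem continuous_magEnergy (hu : IsTestFunction Ω u) : Continuous fun β => magEnergy β u := by
  have hY : ∀ j, Integrable (fun x =>
      ‖((vectorPotential Set.univ (fun y => ‖u y‖ ^ 2) x j : ℝ) : ℂ) * u x‖ ^ 2) volume :=
    fun j => (memLp_two_iff_integrable_sq_norm (hu.memLp_potential_mul j).1).1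
      (hu.memLp_potential_mul j)
  have key : ∀ β, magEnergy β u = ∑ j : Fin 2, ((1 - β) * (∫ x, ‖magField 0 u j x‖ ^ 2)
      + β * (∫ x, ‖magField 1 u j x‖ ^ 2) + (β ^ 2 - β) * ∫ x,
        ‖((vectorPotential Set.univ (fun y => ‖u y‖ ^ 2) x j : ℝ) : ℂ) * u x‖ ^ 2) := by
    intro β
    rw [magEnergy, integral_finsetSum _ fun j _ => hu.integrable_magField_sq β j]
    refine Finset.sum_congr rfl fun j _ => ?_
    rw [← integral_const_mul, ← integral_const_mul, ← integral_const_mul, ← integral_add,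
      ← integral_add]
    · refine integral_congr_ae (Eventually.of_forall fun x => ?_)
      simp only [magField, ← Complex.normSq_eq_norm_sq, Complex.normSq_apply]
      simp
      ring
    · exact ((hu.integrable_magField_sq 0 j).const_mul _).add
        ((hu.integrable_magField_sq 1 j).const_mul _)
    · exact (hY j).const_mul _
    · exact (hu.integrable_magField_sq 0 j).const_mul _
    · exact (hu.integrable_magField_sq 1 j).const_mul _
  simp_rw [key]
  fun_prop

theorem setIntegral_eq {F : Type*} [NormedAddCommGroup F] [NormedSpace ℝ F]
    (hu : IsTestFunction Ω u) {f : Plane → F} (h : ∀ x, u x = 0 → f x = 0) :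
    ∫ x in Ω, f x = ∫ x, f x :=
  setIntegral_eq_integral_of_forall_compl_eq_zero fun x hx => h x (hu.eq_zero hx)

theorem afEnergy_eq (hu : IsTestFunction Ω u) (hΩ : MeasurableSet Ω) (β : ℝ) :
    afEnergy Ω β u (fun j => AnyonGas.pderiv j u) = ENNReal.ofReal (magEnergy β u) := by
  rw [magEnergy, ofReal_integral_eq_lintegral_ofReal (hu.integrable_density β)
    (Eventually.of_forall fun x => by positivity), afEnergy, ← lintegral_indicator hΩ]
  refine lintegral_congr fun x => ?_
  rw [vectorPotential_eq_univ fun y hy => by simp [hu.eq_zero hy]]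
  by_cases hx : x ∈ Ω
  · simp [hx, magField]
  · simp [hx, magField, hu.eq_zero hx, (hu.pderiv _).eq_zero hx]

theorem integral_mul_pderiv {Ω' : Set Plane} {v : Plane → ℂ} (hu : IsTestFunction Ω u)
    (hv : IsTestFunction Ω' v) (j : Fin 2) :
    ∫ x, u x * AnyonGas.pderiv j v x = -∫ x, AnyonGas.pderiv j u x * v x := by
  have hint : ∀ {A B : Set Plane} {f g : Plane → ℂ}, IsTestFunction A f → IsTestFunction B g →
      Integrable (fun x => f x * g x) volume := fun hf hg =>
    (hf.1.continuous.mul hg.1.continuous).integrable_of_hasCompactSupport hf.2.1.mul_right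
  exact integral_mul_fderiv_eq_neg_fderiv_mul_of_integrable (hint (hu.pderiv j) hv)
    (hint hu (hv.pderiv j)) (hint hu hv) (fun x _ => hu.1.differentiable (by simp) x)
    (fun x _ => hv.1.differentiable (by simp) x)

theorem isH10 (hu : IsTestFunction Ω u) : IsH10 Ω u (fun j => AnyonGas.pderiv j u) where
  memLp := (hu.memLp 2).restrict _
  memLp_grad j := ((hu.pderiv j).memLp 2).restrict _
  weak_grad φ hφ j := by
    rw [hφ.setIntegral_eq (f := fun x => AnyonGas.pderiv j u x * φ x) (by simp +contextual),
      hu.setIntegral_eq (f := fun x => u x * AnyonGas.pderiv j φ x) (by simp +contextual)]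
    exact hu.integral_mul_pderiv hφ j
  approx := ⟨fun _ => u, fun _ => hu, by simp, by simp⟩

theorem const_mul (hu : IsTestFunction Ω u) (c : ℂ) : IsTestFunction Ω (fun x => c * u x) :=
  ⟨contDiff_const.mul hu.1, hu.2.1.mul_left, (closure_mono (by
    intro x hx h0; exact hx (by simp [h0]))).trans hu.2.2⟩

theorem pderiv_const_mul (hu : IsTestFunction Ω u) (c : ℂ) (j : Fin 2) (x : Plane) :
    AnyonGas.pderiv j (fun x => c * u x) x = c * AnyonGas.pderiv j u x := by
  rw [pderiv_apply_eq ((hu.1.differentiable (by simp) x).hasFDerivAt.const_mul c)]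
  simp [AnyonGas.pderiv]

/-- The potential is quadratic in the state, so amplitude can be traded for coupling. -/
theorem magEnergy_const_mul (hu : IsTestFunction Ω u) (β c : ℝ) :
    magEnergy β (fun x => (c : ℂ) * u x) = c ^ 2 * magEnergy (β * c ^ 2) u := by
  have hv : ∀ x, vectorPotential Set.univ (fun y => ‖(c : ℂ) * u y‖ ^ 2) x
      = c ^ 2 • vectorPotential Set.univ (fun y => ‖u y‖ ^ 2) x := by
    intro x
    simp only [vectorPotential]
    rw [← integral_smul]
    simp [mul_pow, mul_smul]
  have hf : ∀ j x, magField β (fun x => (c : ℂ) * u x) j x = c * magField (β * c ^ 2) u j x := by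
    intro j x
    simp only [magField, hv, hu.pderiv_const_mul]
    simp
    ring
  simp only [magEnergy, hf, norm_mul, mul_pow, ← Finset.mul_sum]
  rw [integral_const_mul]
  simp

theorem integral_normSq_const_mul (c : ℝ) :
    ∫ x, ‖(c : ℂ) * u x‖ ^ 2 = c ^ 2 * ∫ x, ‖u x‖ ^ 2 := by
  simp only [norm_mul, mul_pow]
  rw [integral_const_mul]
  simp

end IsTestFunction

theorem magEnergy_nonneg (β : ℝ) (u : Plane → ℂ) : 0 ≤ magEnergy β u :=
  integral_nonneg fun x => by positivity

/-! ### Similarities, reflections and complex conjugation. -/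

theorem plane_eq (x : Plane) :
    x = x 0 • (EuclideanSpace.single 0 1 : Plane) + x 1 • (EuclideanSpace.single 1 1 : Plane) := by
  ext i; fin_cases i <;> simp

theorem plane_norm_sq (x : Plane) : ‖x‖ ^ 2 = x 0 ^ 2 + x 1 ^ 2 := by
  simp [EuclideanSpace.norm_sq_eq, Fin.sum_univ_two]

/-- Here `(a, b)` is the image of the first basis vector and `s` is the determinant. -/
theorem linearIsometry_coords (R : Plane ≃ₗᵢ[ℝ] Plane) :
    ∃ a b s : ℝ, a ^ 2 + b ^ 2 = 1 ∧ (s = 1 ∨ s = -1) ∧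
      ∀ x, R x 0 = a * x 0 - s * b * x 1 ∧ R x 1 = b * x 0 + s * a * x 1 := by
  set p := R (EuclideanSpace.single 0 1) with hp
  set q := R (EuclideanSpace.single 1 1) with hq
  have h1 : p 0 ^ 2 + p 1 ^ 2 = 1 := by rw [← plane_norm_sq, hp, R.norm_map]; simp
  have h2 : q 0 ^ 2 + q 1 ^ 2 = 1 := by rw [← plane_norm_sq, hq, R.norm_map]; simp
  have h3 : (p 0 + q 0) ^ 2 + (p 1 + q 1) ^ 2 = 2 := by
    have := plane_norm_sq (p + q)
    rw [hp, hq, ← map_add, R.norm_map, plane_norm_sq] at this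
    simp [hp, hq] at this ⊢
    linarith
  have h4 : p 0 * q 0 + p 1 * q 1 = 0 := by linarith
  -- Lagrange's identity: `det² = |p|²|q|² - (p·q)²`.
  have hs : (p 0 * q 1 - p 1 * q 0) ^ 2 = 1 := by
    linear_combination (q 0 ^ 2 + q 1 ^ 2) * h1 + h2 - (p 0 * q 0 + p 1 * q 1) * h4
  refine ⟨p 0, p 1, p 0 * q 1 - p 1 * q 0, h1, by simpa using hs, fun x => ?_⟩
  have hx : R x = x 0 • p + x 1 • q := by
    conv_lhs => rw [plane_eq x]
    rw [map_add, map_smul, map_smul]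
  have hq0 : q 0 = -(p 0 * q 1 - p 1 * q 0) * p 1 := by
    linear_combination (-q 0) * h1 + p 0 * h4
  have hq1 : q 1 = (p 0 * q 1 - p 1 * q 0) * p 0 := by
    linear_combination (-q 1) * h1 + p 1 * h4
  constructor
  · rw [hx]
    simp only [PiLp.add_apply, PiLp.smul_apply, smul_eq_mul]
    linear_combination x 1 * hq0
  · rw [hx]
    simp only [PiLp.add_apply, PiLp.smul_apply, smul_eq_mul]
    linear_combination x 1 * hq1

/-- The similarity `x ↦ μ R x + t`. -/
noncomputable def similarity (μ : ℝ) (R : Plane ≃ₗᵢ[ℝ] Plane) (t x : Plane) : Plane :=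
  μ • R x + t

theorem integral_comp_similarity {μ : ℝ} (R : Plane ≃ₗᵢ[ℝ] Plane) (t : Plane)
    (f : Plane → ℝ) : ∫ x, f (similarity μ R t x) = (μ ^ 2)⁻¹ * ∫ x, f x := by
  have h1 : ∫ x, f (similarity μ R t x) = ∫ x, f (μ • x + t) :=
    R.measurePreserving.integral_comp R.toHomeomorph.measurableEmbedding (fun x => f (μ • x + t))
  rw [h1, Measure.integral_comp_smul volume (fun x => f (x + t)) μ, integral_add_right_eq_self,
    finrank_plane, smul_eq_mul, abs_of_nonneg (by positivity)]

theorem IsTestFunction.integrable_kernel_apply {Ω : Set Plane} {u : Plane → ℂ}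
    (hu : IsTestFunction Ω u) (x : Plane) (j : Fin 2) :
    Integrable (fun y => ‖u y‖ ^ 2 * perpGrad w0 (x - y) j) volume :=
  (EuclideanSpace.proj (𝕜 := ℝ) j).integrable_comp (hu.integrable_kernel x)

theorem IsTestFunction.vectorPotential_apply {Ω : Set Plane} {u : Plane → ℂ}
    (hu : IsTestFunction Ω u) (x : Plane) (j : Fin 2) :
    vectorPotential Set.univ (fun y => ‖u y‖ ^ 2) x j = ∫ y, ‖u y‖ ^ 2 * perpGrad w0 (x - y) j := by
  rw [AnyonGas.vectorPotential_apply (by simpa using hu.integrable_kernel x),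
    Measure.restrict_univ]

theorem similarity_sub (μ : ℝ) (R : Plane ≃ₗᵢ[ℝ] Plane) (t x y : Plane) :
    similarity μ R t x - similarity μ R t y = μ • R (x - y) := by
  simp [similarity, smul_sub]

/-- `∇^⊥ w₀` intertwines a similarity up to the sign of its determinant. -/
theorem perpGrad_w0_similarity {μ a b s : ℝ} (hμ : 0 < μ) {R : Plane ≃ₗᵢ[ℝ] Plane}
    (hs : s = 1 ∨ s = -1) (hab : a ^ 2 + b ^ 2 = 1)
    (hR : ∀ x, R x 0 = a * x 0 - s * b * x 1 ∧ R x 1 = b * x 0 + s * a * x 1) (w : Plane) :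
    perpGrad w0 w 0 = μ * s * (a * perpGrad w0 (μ • R w) 0 + b * perpGrad w0 (μ • R w) 1) ∧
    perpGrad w0 w 1 = μ * (-b * perpGrad w0 (μ • R w) 0 + a * perpGrad w0 (μ • R w) 1) := by
  have hn : ‖μ • R w‖ ^ 2 = μ ^ 2 * ‖w‖ ^ 2 := by
    rw [norm_smul, R.norm_map, mul_pow, Real.norm_eq_abs, sq_abs]
  simp only [perpGrad_w0_apply_zero, perpGrad_w0_apply_one, hn, PiLp.smul_apply, smul_eq_mul,
    (hR w).1, (hR w).2]
  by_cases hw : w = 0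
  · simp [hw]
  have hw' : ‖w‖ ≠ 0 := by simpa using hw
  constructor
  · field_simp
    rcases hs with rfl | rfl
    · linear_combination (w 1) * hab
    · linear_combination (w 1) * hab
  · field_simp
    linear_combination (-w 0) * hab

theorem hasFDerivAt_similarity (μ : ℝ) (R : Plane ≃ₗᵢ[ℝ] Plane) (t x : Plane) :
    HasFDerivAt (similarity μ R t)
      (μ • (R.toContinuousLinearEquiv : Plane →L[ℝ] Plane)) x :=
  ((R.toContinuousLinearEquiv : Plane →L[ℝ] Plane).hasFDerivAt.const_smul μ).add_const t

/-- A similarity of positive ratio as a homeomorphism. -/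
noncomputable def similarityHomeomorph {μ : ℝ} (hμ : μ ≠ 0) (R : Plane ≃ₗᵢ[ℝ] Plane)
    (t : Plane) : Plane ≃ₜ Plane :=
  (R.toHomeomorph.trans (Homeomorph.smulOfNeZero μ hμ)).trans (Homeomorph.addRight t)

theorem IsTestFunction.comp_similarity {Ω : Set Plane} {u : Plane → ℂ}
    (hu : IsTestFunction Ω u) {μ : ℝ} (hμ : μ ≠ 0) (R : Plane ≃ₗᵢ[ℝ] Plane) (t : Plane) :
    IsTestFunction (similarity μ R t ⁻¹' Ω) (fun x => u (similarity μ R t x)) := by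
  refine ⟨hu.1.comp ?_, hu.2.1.comp_homeomorph (similarityHomeomorph hμ R t), ?_⟩
  · exact (R.contDiff.const_smul μ).add contDiff_const
  · have := tsupport_comp_eq_preimage u (similarityHomeomorph hμ R t)
    refine (this.le).trans (Set.preimage_mono hu.2.2)

/-- Under composition the gradient gains a factor `μ` and the potential a factor `μ⁻¹`, so the
coupling changes by `μ⁻²`. The squared factor `μ` in front cancels the Jacobian. The potential is
built from `∇^⊥`, which sees orientation, whence the sign `s`. -/
theorem IsTestFunction.magEnergy_comp_similarity {Ω : Set Plane} {u : Plane → ℂ}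
    (hu : IsTestFunction Ω u) {μ a b s : ℝ} (hμ : 0 < μ) {R : Plane ≃ₗᵢ[ℝ] Plane}
    (hs : s = 1 ∨ s = -1) (hab : a ^ 2 + b ^ 2 = 1)
    (hR : ∀ x, R x 0 = a * x 0 - s * b * x 1 ∧ R x 1 = b * x 0 + s * a * x 1) (t : Plane) (β : ℝ) :
    magEnergy β (fun x => u (similarity μ R t x)) = magEnergy (s * (β / μ ^ 2)) u := by
  set P := similarity μ R t with hP
  have hv := hu.comp_similarity hμ.ne' R t
  have hI : ∀ f g : Plane → ℝ, (∀ y, g y = f (P y)) → ∫ x, g x = (μ ^ 2)⁻¹ * ∫ x, f x :=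
    fun f g h => by rw [← integral_comp_similarity R t f]; exact integral_congr_ae (ae_of_all _ h)
  have hA0 : ∀ x, vectorPotential Set.univ (fun y => ‖u (P y)‖ ^ 2) x 0
      = μ⁻¹ * s * (a * vectorPotential Set.univ (fun y => ‖u y‖ ^ 2) (P x) 0
        + b * vectorPotential Set.univ (fun y => ‖u y‖ ^ 2) (P x) 1) := by
    intro x
    have h1 : ∀ y, ‖u (P y)‖ ^ 2 * perpGrad w0 (x - y) 0 = (fun z => ‖u z‖ ^ 2 * (μ * s *
        (a * perpGrad w0 (P x - z) 0 + b * perpGrad w0 (P x - z) 1))) (P y) := by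
      intro y
      simp only [hP, similarity_sub]
      rw [(perpGrad_w0_similarity hμ hs hab hR (x - y)).1]
    rw [hv.vectorPotential_apply, hI (fun z => ‖u z‖ ^ 2 * (μ * s *
        (a * perpGrad w0 (P x - z) 0 + b * perpGrad w0 (P x - z) 1))) _ h1,
      hu.vectorPotential_apply, hu.vectorPotential_apply,
      ← integral_const_mul a, ← integral_const_mul b, ← integral_add
        ((hu.integrable_kernel_apply _ 0).const_mul a)
        ((hu.integrable_kernel_apply _ 1).const_mul b), ← integral_const_mul, ← integral_const_mul]
    refine integral_congr_ae (Eventually.of_forall fun z => ?_)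
    simp only
    field_simp
  have hA1 : ∀ x, vectorPotential Set.univ (fun y => ‖u (P y)‖ ^ 2) x 1
      = μ⁻¹ * (-b * vectorPotential Set.univ (fun y => ‖u y‖ ^ 2) (P x) 0
        + a * vectorPotential Set.univ (fun y => ‖u y‖ ^ 2) (P x) 1) := by
    intro x
    have h1 : ∀ y, ‖u (P y)‖ ^ 2 * perpGrad w0 (x - y) 1 = (fun z => ‖u z‖ ^ 2 * (μ *
        (-b * perpGrad w0 (P x - z) 0 + a * perpGrad w0 (P x - z) 1))) (P y) := by
      intro y
      simp only [hP, similarity_sub]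
      rw [(perpGrad_w0_similarity hμ hs hab hR (x - y)).2]
    rw [hv.vectorPotential_apply, hI (fun z => ‖u z‖ ^ 2 * (μ *
        (-b * perpGrad w0 (P x - z) 0 + a * perpGrad w0 (P x - z) 1))) _ h1,
      hu.vectorPotential_apply, hu.vectorPotential_apply,
      ← integral_const_mul (-b), ← integral_const_mul a, ← integral_add
        ((hu.integrable_kernel_apply _ 0).const_mul (-b))
        ((hu.integrable_kernel_apply _ 1).const_mul a), ← integral_const_mul, ← integral_const_mul]
    refine integral_congr_ae (Eventually.of_forall fun z => ?_)
    simp only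
    field_simp
  have hD : ∀ x j, AnyonGas.pderiv j (fun x => u (P x)) x
      = (μ * R (EuclideanSpace.single j 1) 0 : ℝ) * AnyonGas.pderiv 0 u (P x)
        + (μ * R (EuclideanSpace.single j 1) 1 : ℝ) * AnyonGas.pderiv 1 u (P x) := by
    intro x j
    have hc := ((hu.1.differentiable (by simp) (P x)).hasFDerivAt).comp x
      (hasFDerivAt_similarity μ R t x)
    rw [pderiv_apply_eq (f := fun x => u (P x)) hc]
    simp only [ContinuousLinearMap.comp_apply, _root_.smul_apply,
      ContinuousLinearEquiv.coe_coe, LinearIsometryEquiv.coe_toContinuousLinearEquiv]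
    conv_lhs => rw [plane_eq (R (EuclideanSpace.single j 1))]
    simp [AnyonGas.pderiv]
    ring
  have hpt : ∀ x, ∑ j : Fin 2, ‖magField β (fun x => u (P x)) j x‖ ^ 2
      = (fun z => μ ^ 2 * ∑ j : Fin 2, ‖magField (s * (β / μ ^ 2)) u j z‖ ^ 2) (P x) := by
    intro x
    have e0 : magField β (fun x => u (P x)) 0 x = (μ : ℂ) * ((a : ℂ) *
        magField (s * (β / μ ^ 2)) u 0 (P x) + (b : ℂ) * magField (s * (β / μ ^ 2)) u 1 (P x)) := by
      simp only [magField, hA0, hD, (hR _).1, (hR _).2]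
      have : (μ : ℂ) ≠ 0 := by exact_mod_cast hμ.ne'
      simp
      field_simp
      ring
    have e1 : magField β (fun x => u (P x)) 1 x = (μ * s : ℂ) * (-(b : ℂ) *
        magField (s * (β / μ ^ 2)) u 0 (P x) + (a : ℂ) * magField (s * (β / μ ^ 2)) u 1 (P x)) := by
      simp only [magField, hA1, hD, (hR _).1, (hR _).2]
      have : (μ : ℂ) ≠ 0 := by exact_mod_cast hμ.ne'
      rcases hs with rfl | rfl <;> simp <;> field_simp <;> ring
    simp only [Fin.sum_univ_two]
    rw [e0, e1]
    set z := magField (s * (β / μ ^ 2)) u 0 (P x)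
    set w := magField (s * (β / μ ^ 2)) u 1 (P x)
    have hs2 : s ^ 2 = 1 := by rcases hs with rfl | rfl <;> norm_num
    simp only [← Complex.normSq_eq_norm_sq, Complex.normSq_apply]
    simp
    linear_combination (μ ^ 2 * ((-b * z.re + a * w.re) ^ 2 + (-b * z.im + a * w.im) ^ 2)) * hs2
      + (μ ^ 2 * (z.re ^ 2 + z.im ^ 2 + w.re ^ 2 + w.im ^ 2)) * hab
  rw [magEnergy, hI (fun z => μ ^ 2 * ∑ j : Fin 2, ‖magField (s * (β / μ ^ 2)) u j z‖ ^ 2) _ hpt,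
    integral_const_mul, magEnergy]
  field_simp

theorem IsTestFunction.conj {Ω : Set Plane} {u : Plane → ℂ} (hu : IsTestFunction Ω u) :
    IsTestFunction Ω (fun x => (starRingEnd ℂ) (u x)) :=
  ⟨Complex.conjCLE.contDiff.comp hu.1, hu.2.1.comp_left (by simp), (closure_mono (by
    intro x hx h0; exact hx (by simp [h0]))).trans hu.2.2⟩

theorem IsTestFunction.pderiv_conj {Ω : Set Plane} {u : Plane → ℂ} (hu : IsTestFunction Ω u)
    (j : Fin 2) (x : Plane) :
    AnyonGas.pderiv j (fun x => (starRingEnd ℂ) (u x)) x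
      = (starRingEnd ℂ) (AnyonGas.pderiv j u x) := by
  have hc := (Complex.conjCLE.hasFDerivAt (x := u x)).comp x
    (hu.1.differentiable (by simp) x).hasFDerivAt
  rw [pderiv_apply_eq (f := fun x => (starRingEnd ℂ) (u x)) hc]
  simp [AnyonGas.pderiv]

theorem IsTestFunction.magEnergy_conj {Ω : Set Plane} {u : Plane → ℂ} (hu : IsTestFunction Ω u)
    (β : ℝ) : magEnergy β (fun x => (starRingEnd ℂ) (u x)) = magEnergy (-β) u := by
  have hF : ∀ j x, magField β (fun x => (starRingEnd ℂ) (u x)) j x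
      = -(starRingEnd ℂ) (magField (-β) u j x) := by
    intro j x
    simp only [magField, hu.pderiv_conj]
    simp
    ring
  simp [magEnergy, hF]

/-- Transport of trial states by a similarity. -/
theorem IsTestFunction.exists_transport {Ω : Set Plane} {u : Plane → ℂ}
    (hu : IsTestFunction Ω u) {μ : ℝ} (hμ : 0 < μ) (R : Plane ≃ₗᵢ[ℝ] Plane) (t : Plane) (β : ℝ) :
    ∃ v, IsTestFunction (similarity μ R t ⁻¹' Ω) v ∧
      ∫ x, ‖v x‖ ^ 2 = (μ ^ 2)⁻¹ * ∫ x, ‖u x‖ ^ 2 ∧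
      magEnergy β v = magEnergy (β / μ ^ 2) u := by
  obtain ⟨a, b, s, hab, hs, hR⟩ := linearIsometry_coords R
  have hv := hu.comp_similarity hμ.ne' R t
  have hm := integral_comp_similarity (μ := μ) R t (fun x => ‖u x‖ ^ 2)
  rcases id hs with h | h
  · refine ⟨_, hv, hm, ?_⟩
    rw [hu.magEnergy_comp_similarity hμ hs hab hR, h, one_mul]
  -- Determinant `-1`: conjugating the state undoes the sign change of the coupling.
  · refine ⟨_, hv.conj, by simpa using hm, ?_⟩
    rw [hv.magEnergy_conj, hu.magEnergy_comp_similarity hμ hs hab hR, h]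
    congr 1
    ring

/-! ### Gauging away the interaction across a line. -/

/-- The polar angle `arctan (x₁ / x₀)`, a branch on each of the half planes `x₀ < 0`, `x₀ > 0`. -/
noncomputable def planeAngle (x : Plane) : ℝ := Real.arctan (x 1 / x 0)

theorem measurable_planeAngle : Measurable planeAngle :=
  Real.measurable_arctan.comp (by fun_prop)

theorem abs_planeAngle_le (x : Plane) : ‖planeAngle x‖ ≤ Real.pi / 2 :=
  abs_le.2 ⟨(Real.neg_pi_div_two_lt_arctan _).le, (Real.arctan_lt_pi_div_two _).le⟩

theorem hasFDerivAt_planeAngle {x : Plane} (hx : x 0 ≠ 0) :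
    HasFDerivAt planeAngle (innerSL ℝ (perpGrad w0 x)) x := by
  have h0 : HasFDerivAt (fun y : Plane => y 0) (EuclideanSpace.proj (𝕜 := ℝ) (0 : Fin 2)) x :=
    (EuclideanSpace.proj (𝕜 := ℝ) (0 : Fin 2)).hasFDerivAt
  have h1 : HasFDerivAt (fun y : Plane => y 1) (EuclideanSpace.proj (𝕜 := ℝ) (1 : Fin 2)) x :=
    (EuclideanSpace.proj (𝕜 := ℝ) (1 : Fin 2)).hasFDerivAt
  have h := (h1.mul ((hasDerivAt_inv hx).comp_hasFDerivAt x h0)).arctan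
  have hn : x 0 ^ 2 + x 1 ^ 2 ≠ 0 := by positivity
  refine h.congr_fderiv ?_
  ext v
  simp [PiLp.inner_apply, Fin.sum_univ_two, perpGrad_w0_apply_zero, perpGrad_w0_apply_one,
    plane_norm_sq]
  field_simp

/-- The gauge phase `∫ arctan ((x₁ - y₁) / (x₀ - y₀)) |u(y)|² dy`. -/
noncomputable def gaugePhase (u : Plane → ℂ) (x : Plane) : ℝ :=
  ∫ y, ‖u y‖ ^ 2 * planeAngle (x - y)

namespace IsTestFunction

variable {Ω Ω₁ Ω₂ : Set Plane} {u u₁ u₂ : Plane → ℂ}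

/-- The phase is the convolution of a smooth compactly supported density with a bounded function,
hence smooth everywhere, even where the angle jumps. Only its gradient formula needs separation. -/
theorem contDiff_gaugePhase (hu : IsTestFunction Ω u) : ContDiff ℝ ∞ (gaugePhase u) := by
  have hloc : LocallyIntegrable planeAngle volume := by
    refine (locallyIntegrable_const (Real.pi / 2)).mono
      measurable_planeAngle.aestronglyMeasurable (ae_of_all _ fun x => ?_)
    exact (abs_planeAngle_le x).trans (le_abs_self _)
  exact hu.normSq.2.contDiff_convolution_left (n := ⊤) (ContinuousLinearMap.mul ℝ ℝ) hu.normSq.1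
    hloc

/-- At horizontal distance at least `δ` from the source, points within `δ / 2` of `x` stay off the
jump of the angle, and one can differentiate under the integral. -/
theorem hasFDerivAt_gaugePhase (hu : IsTestFunction Ω u) {x : Plane} {δ : ℝ} (hδ : 0 < δ)
    (h : ∀ y, u y ≠ 0 → δ ≤ |x 0 - y 0|) :
    HasFDerivAt (gaugePhase u)
      (innerSL ℝ (vectorPotential Set.univ (fun y => ‖u y‖ ^ 2) x)) x := by
  have hint : Integrable (fun y => ‖u y‖ ^ 2) volume := memLp_one_iff_integrable.1 (hu.memLp_normSq 1)
  have hmeas : ∀ z : Plane, Measurable fun y : Plane => planeAngle (z - y) := fun z =>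
    measurable_planeAngle.comp (measurable_const.sub measurable_id)
  have hsep : ∀ z ∈ Metric.ball x (δ / 2), ∀ y, u y ≠ 0 → δ / 2 ≤ |(z - y) 0| := by
    intro z hz y hy
    have h1 : |z 0 - x 0| ≤ δ / 2 := by
      have := PiLp.norm_apply_le (z - x) 0
      rw [Metric.mem_ball, dist_eq_norm] at hz
      simpa using this.trans hz.le
    have h2 := h y hy
    have h3 : |x 0 - y 0| ≤ |z 0 - x 0| + |(z - y) 0| := by
      have : x 0 - y 0 = -(z 0 - x 0) + (z - y) 0 := by simp
      rw [this]
      exact (abs_add_le _ _).trans (by rw [abs_neg])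
    linarith
  have key := hasFDerivAt_integral_of_dominated_of_fderiv_le
    (F := fun z y => ‖u y‖ ^ 2 * planeAngle (z - y))
    (F' := fun z y => ‖u y‖ ^ 2 • innerSL ℝ (perpGrad w0 (z - y)))
    (bound := fun y => ‖u y‖ ^ 2 * (δ / 2)⁻¹) (μ := volume) (x₀ := x) (𝕜 := ℝ)
    (Metric.ball_mem_nhds x (half_pos hδ)) ?_ ?_ ?_ ?_ (hint.mul_const _) ?_
  · refine key.congr_fderiv ?_
    have hk := hu.integrable_kernel x
    simp only [vectorPotential, Measure.restrict_univ]
    rw [← ContinuousLinearMap.integral_comp_comm _ hk]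
    simp
  · exact Eventually.of_forall fun z => hint.1.mul (hmeas z).aestronglyMeasurable
  · exact hint.mul_bdd (hmeas x).aestronglyMeasurable (ae_of_all _ fun y => abs_planeAngle_le _)
  · have := (innerSL ℝ (E := Plane)).continuous.comp_aestronglyMeasurable (hu.integrable_kernel x).1
    simpa using this
  · refine ae_of_all _ fun y z hz => ?_
    rw [norm_smul, innerSL_apply_norm, norm_perpGrad_w0, Real.norm_of_nonneg (by positivity)]
    by_cases hy : u y = 0
    · simp [hy]
    · have h1 := hsep z hz y hy
      have h2 : |(z - y) 0| ≤ ‖z - y‖ := PiLp.norm_apply_le (z - y) 0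
      gcongr
      exact h1.trans h2
  · refine ae_of_all _ fun y z hz => ?_
    by_cases hy : u y = 0
    · simpa [hy] using hasFDerivAt_const (0 : ℝ) z
    · have h1 := hsep z hz y hy
      have h0 : (z - y) 0 ≠ 0 := abs_pos.1 ((half_pos hδ).trans_le h1)
      have hd := (hasFDerivAt_planeAngle h0).comp z ((hasFDerivAt_id z).sub_const y)
      exact (hd.const_mul (‖u y‖ ^ 2)).congr_fderiv (by ext; simp)

/-- The gauge transform of `u` by the phase generated by `v`. -/
theorem gauge (hu : IsTestFunction Ω₁ u₁) (hv : IsTestFunction Ω₂ u₂) (β : ℝ) :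
    IsTestFunction Ω₁ (fun x => Complex.exp (-Complex.I * β * gaugePhase u₂ x) * u₁ x) := by
  refine ⟨?_, hu.2.1.mul_left, (closure_mono (by
    intro x hx h0; exact hx (by simp [h0]))).trans hu.2.2⟩
  have : ContDiff ℝ ∞ fun x => (gaugePhase u₂ x : ℂ) :=
    Complex.ofRealCLM.contDiff.comp hv.contDiff_gaugePhase
  exact ((contDiff_const.mul this).cexp).mul hu.1

theorem add (hu : IsTestFunction Ω u₁) (hv : IsTestFunction Ω u₂) :
    IsTestFunction Ω (fun x => u₁ x + u₂ x) := by
  refine ⟨hu.1.add hv.1, hu.2.1.add hv.2.1, ?_⟩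
  exact (tsupport_add u₁ u₂).trans (Set.union_subset hu.2.2 hv.2.2)

theorem pderiv_gauge (hu : IsTestFunction Ω₁ u₁) (hv : IsTestFunction Ω₂ u₂) (β : ℝ) (j : Fin 2)
    {x : Plane} {δ : ℝ} (hδ : 0 < δ) (h : ∀ y, u₂ y ≠ 0 → δ ≤ |x 0 - y 0|) :
    AnyonGas.pderiv j (fun x => Complex.exp (-Complex.I * β * gaugePhase u₂ x) * u₁ x) x
      = Complex.exp (-Complex.I * β * gaugePhase u₂ x) * (AnyonGas.pderiv j u₁ x - Complex.I * β *
        vectorPotential Set.univ (fun y => ‖u₂ y‖ ^ 2) x j * u₁ x) := by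
  have h1 := Complex.ofRealCLM.hasFDerivAt.comp x (hv.hasFDerivAt_gaugePhase hδ h)
  have h2 := ((h1.const_mul (-Complex.I * β)).cexp).mul
    (hu.1.differentiable (by simp) x).hasFDerivAt
  refine (pderiv_apply_eq h2 j).trans ?_
  simp [AnyonGas.pderiv, EuclideanSpace.inner_single_right]
  ring

theorem norm_gauge (β t : ℝ) : ‖Complex.exp (-Complex.I * β * t)‖ = 1 := by
  have : -Complex.I * β * t = ((-β * t : ℝ) : ℂ) * Complex.I := by push_cast; ring
  rw [this, Complex.norm_exp_ofReal_mul_I]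

/-- Off the support of `u₂`, differentiating the phase produces exactly `-β A[|u₂|²]`, which cancels
the foreign part of the potential. What remains is the magnetic derivative of `u₁` times a
unimodular factor. -/
theorem norm_magField_glue (hu : IsTestFunction Ω₁ u₁) (hv : IsTestFunction Ω₂ u₂)
    {w : Plane → ℂ} (β : ℝ) {x : Plane}
    (hw : w = fun x => Complex.exp (-Complex.I * β * gaugePhase u₂ x) * u₁ x
      + Complex.exp (-Complex.I * β * gaugePhase u₁ x) * u₂ x)
    (hA : ∀ j, vectorPotential Set.univ (fun y => ‖w y‖ ^ 2) x j
      = vectorPotential Set.univ (fun y => ‖u₁ y‖ ^ 2) x j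
        + vectorPotential Set.univ (fun y => ‖u₂ y‖ ^ 2) x j)
    {δ : ℝ} (hδ : 0 < δ) (h : ∀ y, u₂ y ≠ 0 → δ ≤ |x 0 - y 0|) (hx : x ∉ tsupport u₂)
    (j : Fin 2) :
    ‖magField β w j x‖ ^ 2 = ‖magField β u₁ j x‖ ^ 2 + ‖magField β u₂ j x‖ ^ 2 := by
  have h0 : u₂ x = 0 := image_eq_zero_of_notMem_tsupport hx
  have hp : AnyonGas.pderiv j u₂ x = 0 := by
    rw [AnyonGas.pderiv, fderiv_of_notMem_tsupport (𝕜 := ℝ) hx]; rfl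
  have hp' : AnyonGas.pderiv j
      (fun x => Complex.exp (-Complex.I * β * gaugePhase u₁ x) * u₂ x) x = 0 := by
    rw [AnyonGas.pderiv, fderiv_of_notMem_tsupport (𝕜 := ℝ)]
    · rfl
    · exact fun hx' => hx ((closure_mono (by intro z hz h0; exact hz (by simp [h0]))) hx')
  have hd : AnyonGas.pderiv j w x = Complex.exp (-Complex.I * β * gaugePhase u₂ x) *
      (AnyonGas.pderiv j u₁ x - Complex.I * β *
        vectorPotential Set.univ (fun y => ‖u₂ y‖ ^ 2) x j * u₁ x) := by
    have hadd := ((hu.gauge hv β).1.differentiable (by simp) x).hasFDerivAt.add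
      ((hv.gauge hu β).1.differentiable (by simp) x).hasFDerivAt
    rw [← hu.pderiv_gauge hv β j hδ h, hw]
    refine (pderiv_apply_eq hadd j).trans ?_
    rw [_root_.add_apply]
    exact (congrArg _ hp').trans (add_zero _)
  have h2 : magField β u₂ j x = 0 := by simp [magField, hp, h0]
  have h1 : magField β w j x = Complex.exp (-Complex.I * β * gaugePhase u₂ x) *
      magField β u₁ j x := by
    have hwx : w x = Complex.exp (-Complex.I * β * gaugePhase u₂ x) * u₁ x := by
      simp [hw, h0]
    simp only [magField, hd, hA, hwx]
    push_cast
    linear_combination (Complex.exp (-Complex.I * β * gaugePhase u₂ x) * β *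
      vectorPotential Set.univ (fun y => ‖u₂ y‖ ^ 2) x j * u₁ x) * Complex.I_sq
  rw [h1, h2, norm_mul, norm_gauge]
  simp

/-- Trial states on two sets separated by a line `x₀ = c` can be glued without interaction. -/
theorem exists_glue {c : ℝ} (hu : IsTestFunction Ω₁ u₁) (hv : IsTestFunction Ω₂ u₂)
    (h₁ : ∀ x ∈ Ω₁, x 0 < c) (h₂ : ∀ x ∈ Ω₂, c < x 0) (h₁' : Ω₁ ⊆ Ω) (h₂' : Ω₂ ⊆ Ω) (β : ℝ) :
    ∃ w, IsTestFunction Ω w ∧ ∫ x, ‖w x‖ ^ 2 = (∫ x, ‖u₁ x‖ ^ 2) + ∫ x, ‖u₂ x‖ ^ 2 ∧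
      magEnergy β w = magEnergy β u₁ + magEnergy β u₂ := by
  set w : Plane → ℂ := fun x => Complex.exp (-Complex.I * β * gaugePhase u₂ x) * u₁ x
      + Complex.exp (-Complex.I * β * gaugePhase u₁ x) * u₂ x with hw
  have hwt : IsTestFunction Ω w := ((hu.gauge hv β).mono h₁').add ((hv.gauge hu β).mono h₂')
  have hns : ∀ x, ‖w x‖ ^ 2 = ‖u₁ x‖ ^ 2 + ‖u₂ x‖ ^ 2 := by
    intro x
    by_cases hx : x ∈ Ω₁
    · have : u₂ x = 0 := hv.eq_zero fun h => lt_asymm (h₁ x hx) (h₂ x h)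
      simp only [hw, this, norm_mul, norm_gauge, mul_zero, add_zero, one_mul]
      simp
    · simp only [hw, hu.eq_zero hx, norm_mul, norm_gauge, mul_zero, zero_add, one_mul]
      simp
  have hA : ∀ x j, vectorPotential Set.univ (fun y => ‖w y‖ ^ 2) x j
      = vectorPotential Set.univ (fun y => ‖u₁ y‖ ^ 2) x j
        + vectorPotential Set.univ (fun y => ‖u₂ y‖ ^ 2) x j := by
    intro x j
    rw [hwt.vectorPotential_apply, hu.vectorPotential_apply, hv.vectorPotential_apply,
      ← integral_add (hu.integrable_kernel_apply x j) (hv.integrable_kernel_apply x j)]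
    simp only [hns, add_mul]
  refine ⟨w, hwt, ?_, ?_⟩
  · simp only [hns]
    exact integral_add (memLp_one_iff_integrable.1 (hu.memLp_normSq 1))
      (memLp_one_iff_integrable.1 (hv.memLp_normSq 1))
  · rw [magEnergy, magEnergy, magEnergy, ← integral_add (hu.integrable_density β)
      (hv.integrable_density β)]
    refine integral_congr_ae (ae_of_all _ fun x => ?_)
    simp only
    rw [← Finset.sum_add_distrib]
    refine Finset.sum_congr rfl fun j _ => ?_
    -- The distance from `x` to the line serves as `δ`; it may depend on `x`, so no uniform gap
    -- between the sets is required.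
    by_cases hx₁ : x ∈ tsupport u₁
    · have hxc := h₁ x (hu.2.2 hx₁)
      refine hu.norm_magField_glue hv β hw (hA x) (sub_pos.2 hxc) (fun y hy => ?_)
        (fun h => lt_asymm hxc (h₂ x (hv.2.2 h))) j
      have hy' := h₂ y (hv.2.2 (subset_tsupport _ hy))
      rw [abs_sub_comm]
      exact le_trans (by linarith) (le_abs_self _)
    · by_cases hx₂ : x ∈ tsupport u₂
      · have hxc := h₂ x (hv.2.2 hx₂)
        rw [add_comm]
        refine hv.norm_magField_glue hu β (hw.trans (by funext; exact add_comm _ _))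
          (fun j => (hA x j).trans (add_comm _ _)) (sub_pos.2 hxc) (fun y hy => ?_) hx₁ j
        have hy' := h₁ y (hu.2.2 (subset_tsupport _ hy))
        exact le_trans (by linarith) (le_abs_self _)
      · have hx : x ∉ tsupport w := by
          intro h
          have := (tsupport_add (fun x => Complex.exp (-Complex.I * β * gaugePhase u₂ x) * u₁ x)
            (fun x => Complex.exp (-Complex.I * β * gaugePhase u₁ x) * u₂ x)) h
          rcases this with h' | h'
          · exact hx₁ ((closure_mono (by intro z hz h0; exact hz (by simp [h0]))) h')
          · exact hx₂ ((closure_mono (by intro z hz h0; exact hz (by simp [h0]))) h')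
        have hz : ∀ {f : Plane → ℂ}, x ∉ tsupport f → magField β f j x = 0 := by
          intro f hf
          have hp : AnyonGas.pderiv j f x = 0 := by
            rw [AnyonGas.pderiv, fderiv_of_notMem_tsupport (𝕜 := ℝ) hf]; rfl
          simp [magField, hp, image_eq_zero_of_notMem_tsupport hf]
        simp [hz hx, hz hx₁, hz hx₂]

end IsTestFunction

/-! ### Tiling of boxes. -/

/-- The open rectangle `(0, a) × (0, b)`. -/
def openBox (a b : ℝ) : Set Plane := {x | (0 < x 0 ∧ x 0 < a) ∧ 0 < x 1 ∧ x 1 < b}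

/-- There is a trial state in `(0, a) × (0, b)` with mass `m` and energy `e`. -/
def HasTrial (β a b m e : ℝ) : Prop :=
  ∃ u, IsTestFunction (openBox a b) u ∧ ∫ x, ‖u x‖ ^ 2 = m ∧ magEnergy β u = e

theorem similarity_refl_apply (μ : ℝ) (t x : Plane) :
    similarity μ (LinearIsometryEquiv.refl ℝ Plane) t x = μ • x + t := rfl

namespace HasTrial

variable {β a b a' m e m' e' : ℝ}

/-- Gluing is available only across vertical lines; exchanging coordinates makes it available in the
other direction. -/
theorem swap (h : HasTrial β a b m e) : HasTrial β b a m e := by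
  obtain ⟨u, hu, hm, he⟩ := h
  obtain ⟨v, hv, hvm, hve⟩ := hu.exists_transport one_pos
    (LinearIsometryEquiv.piLpCongrLeft 2 ℝ ℝ (Equiv.swap (0 : Fin 2) 1)) 0 β
  refine ⟨v, hv.mono ?_, by simp [hvm, hm], by simp [hve, he]⟩
  intro x hx
  simp only [similarity, Set.mem_preimage, openBox] at hx
  simp [LinearIsometryEquiv.piLpCongrLeft_apply, Equiv.piCongrLeft'] at hx
  exact ⟨hx.2, hx.1⟩

theorem add (h : HasTrial β a b m e) (h' : HasTrial β a' b m' e') (ha : 0 ≤ a) (ha' : 0 ≤ a') :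
    HasTrial β (a + a') b (m + m') (e + e') := by
  obtain ⟨u, hu, hm, he⟩ := h
  obtain ⟨u', hu', hm', he'⟩ := h'
  obtain ⟨v, hv, hvm, hve⟩ := hu'.exists_transport one_pos
    (LinearIsometryEquiv.refl ℝ Plane) (-EuclideanSpace.single 0 a) β
  have hpre : ∀ x ∈ similarity 1 (LinearIsometryEquiv.refl ℝ Plane)
      (-EuclideanSpace.single 0 a) ⁻¹' openBox a' b,
      (a < x 0 ∧ x 0 < a' + a) ∧ 0 < x 1 ∧ x 1 < b := by
    intro x hx
    simpa [similarity_refl_apply, openBox] using hx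
  obtain ⟨w, hw, hwm, hwe⟩ := hu.exists_glue (Ω := openBox (a + a') b) (c := a) hv
    (fun x hx => hx.1.2) (fun x hx => (hpre x hx).1.1)
    (fun x hx => ⟨⟨hx.1.1, by linarith [hx.1.2]⟩, hx.2⟩)
    (fun x hx => ⟨⟨ha.trans_lt (hpre x hx).1.1, by linarith [(hpre x hx).1.2]⟩, (hpre x hx).2⟩) β
  refine ⟨w, hw, ?_, ?_⟩
  · rw [hwm, hm, hvm, hm']; simp
  · rw [hwe, he, hve, ← he']; simp

theorem nsmul (h : HasTrial β a b m e) (ha : 0 ≤ a) (n : ℕ) :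
    HasTrial β (n * a) b (n * m) (n * e) := by
  induction n with
  | zero =>
    refine ⟨fun _ => 0, ⟨contDiff_const, HasCompactSupport.zero, by simp⟩, by simp, ?_⟩
    simp [magEnergy, magField, pderiv]
  | succ n ih =>
    have := ih.add h (by positivity) ha
    push_cast
    simpa only [add_mul, one_mul] using this

/-- An `n × n` array of copies has mass `n² m` and energy `n² e`. Shrinking it to the unit square
divides the mass by `n²`, preserves the energy and multiplies the coupling by `n²`. -/
theorem tile (h : HasTrial β 1 1 m e) {n : ℕ} (hn : n ≠ 0) :
    HasTrial (n ^ 2 * β) 1 1 m (n ^ 2 * e) := by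
  obtain ⟨u, hu, hm, he⟩ := ((h.nsmul zero_le_one n).swap.nsmul zero_le_one n)
  have hn' : (0 : ℝ) < n := by positivity
  obtain ⟨v, hv, hvm, hve⟩ := hu.exists_transport hn' (LinearIsometryEquiv.refl ℝ Plane) 0
    (n ^ 2 * β)
  refine ⟨v, hv.mono ?_, ?_, ?_⟩
  · intro x hx
    simpa [similarity_refl_apply, openBox, hn', mul_lt_iff_lt_one_right] using hx
  · rw [hvm, hm]; field_simp
  · rw [hve, mul_div_cancel_left₀ _ (by positivity), he]; ring

end HasTrial

/-! ### The curl of the potential and the magnetic lower bound. -/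

theorem measurePreserving_toPlane :
    MeasurePreserving (fun p : ℝ × ℝ => (!₂[p.1, p.2] : Plane)) volume volume :=
  (PiLp.volume_preserving_toLp (Fin 2)).comp (volume_preserving_finTwoArrow ℝ).symm

theorem continuous_toPlane : Continuous fun p : ℝ × ℝ => (!₂[p.1, p.2] : Plane) := by
  refine (PiLp.continuous_toLp 2 _).comp (continuous_pi fun i => ?_)
  fin_cases i
  · exact continuous_fst
  · exact continuous_snd

theorem integral_plane_eq (g : Plane → ℝ) : ∫ x, g x = ∫ p : ℝ × ℝ, g !₂[p.1, p.2] := by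
  refine (measurePreserving_toPlane.integral_comp ?_ g).symm
  exact ((MeasurableEquiv.finTwoArrow (α := ℝ)).symm.trans
    (MeasurableEquiv.toLp 2 (Fin 2 → ℝ))).measurableEmbedding

/-- The unit vector with polar angle `θ`. -/
noncomputable def unitVector (θ : ℝ) : Plane := !₂[Real.cos θ, Real.sin θ]

theorem norm_unitVector (θ : ℝ) : ‖unitVector θ‖ = 1 := by
  rw [← sq_eq_sq₀ (norm_nonneg _) zero_le_one, plane_norm_sq]
  simp [unitVector]

theorem continuous_unitVector : Continuous unitVector :=
  continuous_toPlane.comp (Real.continuous_cos.prodMk Real.continuous_sin)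

/-- `Δ log |x| = 2 π δ₀`, tested against a compactly supported function. -/
theorem integral_kernel_mul_pderiv {f : Plane → ℝ} (hf : ContDiff ℝ ∞ f)
    (hc : HasCompactSupport f) :
    ∫ z, (perpGrad w0 z 1 * pderiv 0 f z - perpGrad w0 z 0 * pderiv 1 f z)
      = -(2 * Real.pi) * f 0 := by
  have hf1 : ContDiff ℝ 1 f := hf.of_le (by simp)
  rw [integral_plane_eq, ← integral_comp_polarCoord_symm]
  have hG : Continuous fun p : ℝ × ℝ => fderiv ℝ f (p.1 • unitVector p.2) (unitVector p.2) :=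
    ((hf.continuous_fderiv (by simp)).comp (continuous_fst.smul
      (continuous_unitVector.comp continuous_snd))).clm_apply
      (continuous_unitVector.comp continuous_snd)
  -- The integrand is `z · ∇f / |z|²`, the radial derivative divided by `r`; the polar Jacobian
  -- cancels that singularity.
  have heq : ∀ p ∈ polarCoord.target,
      p.1 • (fun p : ℝ × ℝ => perpGrad w0 !₂[p.1, p.2] 1 * pderiv 0 f !₂[p.1, p.2]
        - perpGrad w0 !₂[p.1, p.2] 0 * pderiv 1 f !₂[p.1, p.2]) (polarCoord.symm p)
      = fderiv ℝ f (p.1 • unitVector p.2) (unitVector p.2) := by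
    rintro ⟨r, θ⟩ hp
    have hr : 0 < r := hp.1
    have h1 : (!₂[(polarCoord.symm (r, θ)).1, (polarCoord.symm (r, θ)).2] : Plane)
        = r • unitVector θ := by
      ext i; fin_cases i <;> simp [unitVector, polarCoord]
    have h2 : fderiv ℝ f (r • unitVector θ) (unitVector θ)
        = Real.cos θ * pderiv 0 f (r • unitVector θ)
          + Real.sin θ * pderiv 1 f (r • unitVector θ) := by
      generalize r • unitVector θ = p
      rw [plane_eq (unitVector θ)]
      simp [pderiv, unitVector]
    simp only [h1, h2, perpGrad_w0_apply_zero, perpGrad_w0_apply_one, norm_smul, norm_unitVector]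
    simp [unitVector]
    field_simp
    ring
  rw [setIntegral_congr_fun polarCoord.open_target.measurableSet heq, polarCoord_target]
  obtain ⟨R, hR⟩ := hc.isBounded.subset_ball 0
  have hint : IntegrableOn (fun p : ℝ × ℝ => fderiv ℝ f (p.1 • unitVector p.2) (unitVector p.2))
      (Set.Ioi 0 ×ˢ Set.Ioo (-Real.pi) Real.pi) := by
    have hK : IntegrableOn (fun p : ℝ × ℝ => fderiv ℝ f (p.1 • unitVector p.2) (unitVector p.2))
        (Set.Icc 0 R ×ˢ Set.Icc (-Real.pi) Real.pi) :=
      hG.continuousOn.integrableOn_compact (isCompact_Icc.prod isCompact_Icc)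
    refine hK.of_forall_sdiff_eq_zero (measurableSet_Ioi.prod measurableSet_Ioo) ?_
    rintro ⟨r, θ⟩ ⟨⟨hr, hθ⟩, hn⟩
    have hr' : 0 < r := hr
    have hRr : R < r := by
      by_contra h
      exact hn ⟨⟨hr'.le, not_lt.1 h⟩, Set.Ioo_subset_Icc_self hθ⟩
    have : r • unitVector θ ∉ tsupport f := by
      intro h
      have := hR h
      rw [mem_ball_zero_iff, norm_smul, norm_unitVector, Real.norm_of_nonneg hr'.le] at this
      linarith
    simp [fderiv_of_notMem_tsupport (𝕜 := ℝ) this]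
  have hinner : ∀ θ, ∫ r in Set.Ioi (0 : ℝ), fderiv ℝ f (r • unitVector θ) (unitVector θ) = -f 0 := by
    intro θ
    have hd : ∀ r : ℝ, deriv (fun r : ℝ => f (r • unitVector θ)) r
        = fderiv ℝ f (r • unitVector θ) (unitVector θ) := by
      intro r
      have h1 : HasDerivAt (fun r : ℝ => r • unitVector θ) (unitVector θ) r := by
        simpa using (hasDerivAt_id r).smul_const (unitVector θ)
      exact ((hf.differentiable (by simp) (r • unitVector θ)).hasFDerivAt.comp_hasDerivAt r h1).deriv
    have hcs : HasCompactSupport fun r : ℝ => f (r • unitVector θ) := by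
      refine HasCompactSupport.of_support_subset_isCompact
        (isCompact_closedBall (0 : ℝ) R) fun r hr => ?_
      have := hR (subset_tsupport f hr)
      rw [mem_ball_zero_iff, norm_smul, norm_unitVector, mul_one] at this
      simpa using this.le
    have hsm : ContDiff ℝ 1 fun r : ℝ => f (r • unitVector θ) :=
      hf1.comp (contDiff_id.smul contDiff_const)
    have := hcs.integral_Ioi_deriv_eq hsm 0
    simpa [hd] using this
  rw [Measure.volume_eq_prod, IntegrableOn, ← Measure.prod_restrict] at hint
  rw [Measure.volume_eq_prod, ← Measure.prod_restrict, integral_prod_symm _ hint]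
  simp only [hinner]
  rw [setIntegral_const, Real.volume_real_Ioo_of_le (by linarith [Real.pi_pos]), smul_eq_mul]
  ring

theorem integrableOn_kernel_apply (R : ℝ) (j : Fin 2) :
    IntegrableOn (fun z => perpGrad w0 z j) (Metric.ball 0 R) volume := by
  refine integrableOn_ball_of_norm_le_rpow (C := 1) (α := 1) (by simp)
    (by rw [finrank_plane]; norm_num) (ae_of_all _ fun x => ?_) ?_
  · rw [Real.rpow_neg (norm_nonneg _), Real.rpow_one, one_mul, ← norm_perpGrad_w0]
    exact PiLp.norm_apply_le _ j
  · exact ((EuclideanSpace.proj (𝕜 := ℝ) j).continuous.measurable.comp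
      measurable_perpGrad_w0).aestronglyMeasurable

/-- This justifies Fubini for the curl identity. The kernel is not globally integrable, but compact
supports allow truncating it to a ball of radius `R₁ + R₂`. -/
theorem integrable_interaction {f g : Plane → ℝ} (hf : Continuous f) (hfc : HasCompactSupport f)
    (hg : Continuous g) (hgc : HasCompactSupport g) (j : Fin 2) :
    Integrable (fun p : Plane × Plane => f p.2 * perpGrad w0 (p.1 - p.2) j * g p.1)
      (volume.prod volume) := by
  obtain ⟨R₁, hR₁⟩ := hfc.isBounded.subset_ball 0
  obtain ⟨R₂, hR₂⟩ := hgc.isBounded.subset_ball 0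
  obtain ⟨C, hC⟩ := hgc.exists_bound_of_continuous hg
  have hK := (integrable_indicator_iff Metric.isOpen_ball.measurableSet).2
    (integrableOn_kernel_apply (R₁ + R₂) j)
  have h1 := (hf.integrable_of_hasCompactSupport hfc (μ := volume)).convolution_integrand
    (ContinuousLinearMap.mul ℝ ℝ) hK
  have h2 := h1.mul_bdd (g := fun p : Plane × Plane => g p.1) (c := C)
    (hg.comp continuous_fst).aestronglyMeasurable (ae_of_all _ fun p => hC p.1)
  refine h2.congr (ae_of_all _ fun p => ?_)
  simp only [ContinuousLinearMap.mul_apply']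
  by_cases h3 : f p.2 = 0
  · simp [h3]
  by_cases h4 : g p.1 = 0
  · simp [h4]
  have h5 := hR₁ (subset_tsupport f h3)
  have h6 := hR₂ (subset_tsupport g h4)
  rw [Set.indicator_of_mem]
  rw [mem_ball_zero_iff] at *
  linarith [norm_sub_le p.1 p.2]

namespace IsTestFunction
variable {Ω : Set Plane} {u : Plane → ℂ}

theorem pderiv_normSq (hu : IsTestFunction Ω u) (j : Fin 2) (x : Plane) :
    AnyonGas.pderiv j (fun y => ‖u y‖ ^ 2) x
      = 2 * ((u x).re * (AnyonGas.pderiv j u x).re + (u x).im * (AnyonGas.pderiv j u x).im) := by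
  rw [pderiv_apply_eq (hu.1.differentiable (by simp) x).hasFDerivAt.norm_sq]
  simp [AnyonGas.pderiv, Complex.inner]
  ring

/-- The curl of `A[|u|²]` is `2 π |u|²`, in weak form. -/
theorem integral_vectorPotential_mul_pderiv (hu : IsTestFunction Ω u) :
    ∫ x, (vectorPotential Set.univ (fun y => ‖u y‖ ^ 2) x 1
        * AnyonGas.pderiv 0 (fun y => ‖u y‖ ^ 2) x
      - vectorPotential Set.univ (fun y => ‖u y‖ ^ 2) x 0
        * AnyonGas.pderiv 1 (fun y => ‖u y‖ ^ 2) x)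
      = -(2 * Real.pi) * ∫ x, ‖u x‖ ^ 4 := by
  set ϱ : Plane → ℝ := fun y => ‖u y‖ ^ 2 with hϱ
  obtain ⟨hs, hc⟩ := hu.normSq
  have hI : ∀ i j, Integrable (fun p : Plane × Plane =>
      ϱ p.2 * perpGrad w0 (p.1 - p.2) i * AnyonGas.pderiv j ϱ p.1) (volume.prod volume) :=
    fun i j => integrable_interaction hs.continuous hc (contDiff_pderiv hs j).continuous
      (hasCompactSupport_pderiv hc j) i
  have h1 : ∀ x, vectorPotential Set.univ ϱ x 1 * AnyonGas.pderiv 0 ϱ x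
      - vectorPotential Set.univ ϱ x 0 * AnyonGas.pderiv 1 ϱ x
      = ∫ y, (ϱ y * perpGrad w0 (x - y) 1 * AnyonGas.pderiv 0 ϱ x
        - ϱ y * perpGrad w0 (x - y) 0 * AnyonGas.pderiv 1 ϱ x) := by
    intro x
    rw [hu.vectorPotential_apply, hu.vectorPotential_apply, ← integral_mul_const,
      ← integral_mul_const, integral_sub ((hu.integrable_kernel_apply x 1).mul_const _)
        ((hu.integrable_kernel_apply x 0).mul_const _)]
  simp only [h1]
  -- After Fubini, the inner integral for fixed `y` is the fundamental solution identity translated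
  -- to `y`.
  rw [integral_integral_swap ((hI 1 0).sub (hI 0 1)), ← integral_const_mul]
  refine integral_congr_ae (ae_of_all _ fun y => ?_)
  simp only
  have hft : ∀ j z, AnyonGas.pderiv j (fun z => ϱ (z + y)) z = AnyonGas.pderiv j ϱ (z + y) := by
    intro j z
    simp only [AnyonGas.pderiv, fderiv_comp_add_right]
  have hk := integral_kernel_mul_pderiv (f := fun z => ϱ (z + y))
    (hs.comp (contDiff_id.add contDiff_const)) (hc.comp_homeomorph (Homeomorph.addRight y))
  rw [← integral_sub_right_eq_self _ y] at hk
  simp only [hft, sub_add_cancel, zero_add] at hk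
  calc _ = ϱ y * ∫ x, (perpGrad w0 (x - y) 1 * AnyonGas.pderiv 0 ϱ x
        - perpGrad w0 (x - y) 0 * AnyonGas.pderiv 1 ϱ x) := by
        rw [← integral_const_mul]
        refine integral_congr_ae (ae_of_all _ fun x => ?_)
        simp only
        ring
    _ = _ := by rw [hk, hϱ]; ring

theorem pderiv_comm (hu : IsTestFunction Ω u) (i j : Fin 2) (x : Plane) :
    AnyonGas.pderiv i (AnyonGas.pderiv j u) x = AnyonGas.pderiv j (AnyonGas.pderiv i u) x := by
  have hs : IsSymmSndFDerivAt ℝ u x :=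
    (contDiff_infty.1 hu.1 2).contDiffAt.isSymmSndFDerivAt (by simp)
  have hd : HasFDerivAt (fderiv ℝ u) (fderiv ℝ (fderiv ℝ u) x) x :=
    ((hu.1.fderiv_right (m := ∞) (by simp)).differentiable (by simp) x).hasFDerivAt
  have h : ∀ i j : Fin 2, AnyonGas.pderiv i (AnyonGas.pderiv j u) x
      = fderiv ℝ (fderiv ℝ u) x (EuclideanSpace.single i 1) (EuclideanSpace.single j 1) := by
    intro i j
    have := hd.clm_apply (hasFDerivAt_const (EuclideanSpace.single j (1 : ℝ)) x)
    refine (pderiv_apply_eq this i).trans ?_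
    simp
  rw [h, h, hs]

/-- Two integrations by parts and the symmetry of second derivatives show that the complex integral
equals its conjugate. -/
theorem integral_im_conj_pderiv (hu : IsTestFunction Ω u) :
    ∫ x, ((starRingEnd ℂ) (AnyonGas.pderiv 0 u x) * AnyonGas.pderiv 1 u x).im = 0 := by
  have hint : Integrable (fun x => (starRingEnd ℂ) (AnyonGas.pderiv 0 u x)
      * AnyonGas.pderiv 1 u x) volume :=
    ((hu.pderiv 0).conj.1.continuous.mul (hu.pderiv 1).1.continuous).integrable_of_hasCompactSupport
      (hu.pderiv 1).2.1.mul_left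
  have him : ∫ x, ((starRingEnd ℂ) (AnyonGas.pderiv 0 u x) * AnyonGas.pderiv 1 u x).im
      = (∫ x, (starRingEnd ℂ) (AnyonGas.pderiv 0 u x) * AnyonGas.pderiv 1 u x).im :=
    integral_im hint
  rw [him, ← Complex.conj_eq_iff_im, ← integral_conj]
  have h1 := hu.conj.integral_mul_pderiv (hu.pderiv 1) 0
  have h2 := hu.conj.integral_mul_pderiv (hu.pderiv 0) 1
  simp only [hu.pderiv_conj] at h1 h2
  simp only [hu.pderiv_comm 0 1] at h1
  rw [h1, neg_inj] at h2
  rw [h2]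
  refine integral_congr_ae (ae_of_all _ fun x => ?_)
  simp [mul_comm]

/-- The magnetic lower bound `∫ |(-i∇ + βA)u|² ≥ ∫ curl(βA) |u|²`. -/
theorem le_magEnergy (hu : IsTestFunction Ω u) (β : ℝ) :
    2 * Real.pi * β * ∫ x, ‖u x‖ ^ 4 ≤ magEnergy β u := by
  set A := fun x => vectorPotential Set.univ (fun y => ‖u y‖ ^ 2) x with hA
  set ϱ : Plane → ℝ := fun y => ‖u y‖ ^ 2 with hϱ
  have hpt : ∀ x, -2 * ((starRingEnd ℂ) (AnyonGas.pderiv 0 u x) * AnyonGas.pderiv 1 u x).im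
      - β * (A x 1 * AnyonGas.pderiv 0 ϱ x - A x 0 * AnyonGas.pderiv 1 ϱ x)
      ≤ ∑ j : Fin 2, ‖magField β u j x‖ ^ 2 := by
    intro x
    -- The cross term of this square consists of a Jacobian term, whose integral vanishes, and a
    -- term pairing `A` with `∇|u|²`, which gives the curl.
    have hsq := sq_nonneg ‖magField β u 0 x - Complex.I * magField β u 1 x‖
    have hm : ∀ j, magField β u j x
        = -Complex.I * AnyonGas.pderiv j u x + ((β * A x j : ℝ) : ℂ) * u x := fun _ => rfl
    have hp : ∀ j, AnyonGas.pderiv j ϱ x = 2 * ((u x).re * (AnyonGas.pderiv j u x).re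
        + (u x).im * (AnyonGas.pderiv j u x).im) := fun j => hu.pderiv_normSq j x
    simp only [Fin.sum_univ_two, hp, hm, ← Complex.normSq_eq_norm_sq,
      Complex.normSq_apply] at hsq ⊢
    simp at hsq ⊢
    linarith
  have hi1 : Integrable (fun x => ((starRingEnd ℂ) (AnyonGas.pderiv 0 u x)
      * AnyonGas.pderiv 1 u x).im) volume :=
    (((hu.pderiv 0).conj.1.continuous.mul
      (hu.pderiv 1).1.continuous).integrable_of_hasCompactSupport (hu.pderiv 1).2.1.mul_left).im
  have hj : ∀ i j, Integrable (fun x => A x i * AnyonGas.pderiv j ϱ x) volume := by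
    intro i j
    -- `A_i ∂_j |u|²` equals `2 Re (A_i u · conj (∂_j u))`, a product of two `L²` functions.
    have h1 := ((hu.memLp_potential_mul i).integrable_mul ((hu.pderiv j).conj.memLp 2)).re
    refine (h1.const_mul 2).congr (ae_of_all _ fun x => ?_)
    have := hu.pderiv_normSq j x
    simp only [hϱ, this]
    simp [hA]
    ring
  have hi2 : Integrable (fun x => A x 1 * AnyonGas.pderiv 0 ϱ x - A x 0 * AnyonGas.pderiv 1 ϱ x)
      volume := (hj 1 0).sub (hj 0 1)
  have h := integral_mono ((hi1.const_mul (-2)).sub (hi2.const_mul β)) (hu.integrable_density β) hpt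
  rw [integral_sub' (hi1.const_mul (-2)) (hi2.const_mul β), integral_const_mul, integral_const_mul,
    hu.integral_im_conj_pderiv, hu.integral_vectorPotential_mul_pderiv] at h
  refine le_trans (le_of_eq ?_) h
  ring

end IsTestFunction

/-! ### Approximation of `H¹₀` states by test functions. -/

section Lp

variable {α E : Type*} [MeasurableSpace α] {μ : Measure α} [NormedAddCommGroup E] {p : ℝ≥0∞}

theorem tendsto_eLpNorm_of_tendsto_sub {F : ℕ → α → E} {f : α → E} (hp : 1 ≤ p)
    (hF : ∀ n, MemLp (F n) p μ) (hf : MemLp f p μ)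
    (h : Tendsto (fun n => eLpNorm (fun x => F n x - f x) p μ) atTop (𝓝 0)) :
    Tendsto (fun n => eLpNorm (F n) p μ) atTop (𝓝 (eLpNorm f p μ)) := by
  have h1 : Tendsto (fun n => eLpNorm f p μ - eLpNorm (fun x => F n x - f x) p μ) atTop
      (𝓝 (eLpNorm f p μ)) := by
    simpa using ENNReal.Tendsto.sub (tendsto_const_nhds (x := eLpNorm f p μ)) h (Or.inl hf.2.ne)
  have h2 : Tendsto (fun n => eLpNorm f p μ + eLpNorm (fun x => F n x - f x) p μ) atTop
      (𝓝 (eLpNorm f p μ)) := by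
    simpa using (tendsto_const_nhds (x := eLpNorm f p μ)).add h
  refine tendsto_of_tendsto_of_tendsto_of_le_of_le h1 h2 (fun n => ?_) (fun n => ?_)
  · refine tsub_le_iff_right.2 ?_
    have := eLpNorm_sub_le (hF n).1 ((hF n).1.sub hf.1) hp
    simpa [Pi.sub_def] using this
  · have := eLpNorm_add_le hf.1 ((hF n).1.sub hf.1) hp
    simpa [Pi.sub_def, Pi.add_def] using this

theorem sq_eLpNorm_two (f : α → E) : eLpNorm f 2 μ ^ 2 = ∫⁻ x, ‖f x‖ₑ ^ 2 ∂μ := by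
  have := eLpNorm_nnreal_pow_eq_lintegral (f := f) (μ := μ) (p := 2) (by norm_num)
  simpa using this

theorem integral_norm_sq_eq {f : α → E} (hf : MemLp f 2 μ) :
    ∫ x, ‖f x‖ ^ 2 ∂μ = (eLpNorm f 2 μ).toReal ^ 2 := by
  rw [← ENNReal.toReal_pow, sq_eLpNorm_two,
    integral_eq_lintegral_of_nonneg_ae (ae_of_all _ fun x => by positivity)
      (show AEStronglyMeasurable (fun x => ‖f x‖ ^ 2) μ from hf.1.norm.pow 2)]
  congr 1
  refine lintegral_congr fun x => ?_
  rw [ENNReal.ofReal_pow (norm_nonneg _), ofReal_norm]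

end Lp

theorem tendsto_eLpNorm_mul_sub {μ : Measure Plane} {p : ℝ≥0∞} (hp : 1 ≤ p)
    {F : ℕ → Plane → ℂ} {f : Plane → ℂ} {c : ℕ → ℝ} (hF : ∀ n, MemLp (F n) p μ) (hf : MemLp f p μ)
    (hc : Tendsto c atTop (𝓝 1))
    (h : Tendsto (fun n => eLpNorm (fun x => F n x - f x) p μ) atTop (𝓝 0)) :
    Tendsto (fun n => eLpNorm (fun x => (c n : ℂ) * F n x - f x) p μ) atTop (𝓝 0) := by
  have hc1 : Tendsto (fun n => ‖(c n : ℂ)‖ₑ) atTop (𝓝 1) := by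
    have := ((Complex.continuous_ofReal.tendsto 1).comp hc).enorm
    simpa using this
  have hc2 : Tendsto (fun n => ‖(c n : ℂ) - 1‖ₑ) atTop (𝓝 0) := by
    have := (((Complex.continuous_ofReal.tendsto 1).comp hc).sub_const 1).enorm
    simpa using this
  have hlim : Tendsto (fun n => ‖(c n : ℂ)‖ₑ * eLpNorm (fun x => F n x - f x) p μ
      + ‖(c n : ℂ) - 1‖ₑ * eLpNorm f p μ) atTop (𝓝 0) := by
    have h1 := ENNReal.Tendsto.mul hc1 (Or.inr ENNReal.zero_ne_top) h (Or.inr ENNReal.one_ne_top)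
    have h2 := ENNReal.Tendsto.mul_const hc2 (b := eLpNorm f p μ) (Or.inr hf.2.ne)
    simpa using h1.add h2
  refine tendsto_of_tendsto_of_tendsto_of_le_of_le tendsto_const_nhds hlim
    (fun _ => zero_le) fun n => ?_
  have h1 : (fun x => (c n : ℂ) * F n x - f x)
      = ((c n : ℂ) • fun x => F n x - f x) + (((c n : ℂ) - 1) • f) := by
    funext x
    simp
    ring
  simp only [h1]
  refine (eLpNorm_add_le (((hF n).sub hf).const_smul _).1 (hf.const_smul _).1 hp).trans ?_
  rw [eLpNorm_const_smul, eLpNorm_const_smul]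
  exact le_rfl

theorem norm_fderiv_le (φ : Plane → ℂ) (x : Plane) :
    ‖fderiv ℝ φ x‖ ≤ ‖‖pderiv 0 φ x‖ + ‖pderiv 1 φ x‖‖ := by
  rw [Real.norm_of_nonneg (by positivity)]
  refine ContinuousLinearMap.opNorm_le_bound _ (by positivity) fun v => ?_
  conv_lhs => rw [plane_eq v, map_add, map_smul, map_smul]
  refine (norm_add_le _ _).trans ?_
  rw [norm_smul, norm_smul, add_mul, mul_comm _ ‖v‖, mul_comm _ ‖v‖]
  exact add_le_add
    (mul_le_mul_of_nonneg_right (PiLp.norm_apply_le v 0) (norm_nonneg _))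
    (mul_le_mul_of_nonneg_right (PiLp.norm_apply_le v 1) (norm_nonneg _))

/-- The Sobolev inequality `‖φ‖_{L⁶} ≤ C ‖∇φ‖_{L²}` on a bounded set. -/
theorem exists_sobolev_const {Ω : Set Plane} (hΩ : Bornology.IsBounded Ω) :
    ∃ C : ℝ≥0∞, C ≠ ⊤ ∧ ∀ φ, IsTestFunction Ω φ →
      eLpNorm φ 6 (volume.restrict Ω) ≤ C * (eLpNorm (pderiv 0 φ) 2 (volume.restrict Ω)
        + eLpNorm (pderiv 1 φ) 2 (volume.restrict Ω)) := by
  -- The exponent `2` is critical in the plane, so the embedding is taken from `p = 3/2`, where `2/3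
  -- - 1/2 = 1/6`; Hölder on the bounded set then passes from `L^{3/2}` to `L²`.
  obtain ⟨p, hp⟩ : ∃ p : NNReal, (p : ℝ) = 3 / 2 := ⟨3 / 2, by norm_num⟩
  obtain ⟨q, hq⟩ : ∃ q : NNReal, q = 6 := ⟨6, rfl⟩
  have hp1 : 1 ≤ p := by rw [← NNReal.coe_le_coe, hp]; norm_num
  have hp2 : (p : ℝ≥0∞) ≤ 2 := by
    rw [← ENNReal.toReal_le_toReal (by simp) (by simp), ENNReal.coe_toReal, hp]; norm_num
  set K : ℝ≥0∞ := (volume.restrict Ω) Set.univ ^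
    (1 / (p : ℝ≥0∞).toReal - 1 / (2 : ℝ≥0∞).toReal) with hK
  have hvol : (volume.restrict Ω) Set.univ ≠ ⊤ := by
    rw [Measure.restrict_apply_univ]; exact hΩ.measure_lt_top.ne
  have hKt : K ≠ ⊤ :=
    ENNReal.rpow_ne_top_of_nonneg (by rw [ENNReal.coe_toReal, hp]; norm_num) hvol
  refine ⟨eLpNormLESNormFDerivOfLeConst ℂ (volume : Measure Plane) Ω p q * K,
    ENNReal.mul_ne_top ENNReal.coe_ne_top hKt, fun φ hφ => ?_⟩
  have h1 := eLpNorm_le_eLpNorm_fderiv_of_le (volume : Measure Plane) (s := Ω)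
    (hφ.1.of_le (by simp) : ContDiff ℝ 1 φ) ((subset_tsupport φ).trans hφ.2.2)
    (p := p) (q := q) hp1
    (by rw [← NNReal.coe_lt_coe, hp, finrank_plane]; norm_num)
    (by rw [finrank_plane, NNReal.coe_inv, hp, hq]; norm_num) hΩ
  have hsupp : Function.support (fun x => ‖fderiv ℝ φ x‖) ⊆ Ω := by
    intro x hx
    by_contra hxΩ
    refine hx ?_
    simp only
    rw [fderiv_of_notMem_tsupport (𝕜 := ℝ) fun h => hxΩ (hφ.2.2 h), norm_zero]
  have h2 : eLpNorm (fderiv ℝ φ) p (volume.restrict Ω) = eLpNorm (fderiv ℝ φ) p volume := by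
    rw [← eLpNorm_norm (fderiv ℝ φ), ← eLpNorm_norm (fderiv ℝ φ)]
    exact eLpNorm_restrict_eq_of_support_subset hsupp
  have h3 : eLpNorm (fderiv ℝ φ) p (volume.restrict Ω)
      ≤ eLpNorm (fderiv ℝ φ) 2 (volume.restrict Ω) * K :=
    eLpNorm_le_eLpNorm_mul_rpow_measure_univ hp2
      (hφ.1.continuous_fderiv (by simp)).aestronglyMeasurable
  have h4 : eLpNorm (fderiv ℝ φ) 2 (volume.restrict Ω)
      ≤ eLpNorm (pderiv 0 φ) 2 (volume.restrict Ω) + eLpNorm (pderiv 1 φ) 2 (volume.restrict Ω) := by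
    refine (eLpNorm_mono (norm_fderiv_le φ)).trans ?_
    refine (eLpNorm_add_le (hφ.pderiv 0).1.continuous.norm.aestronglyMeasurable
      (hφ.pderiv 1).1.continuous.norm.aestronglyMeasurable (by norm_num)).trans ?_
    rw [eLpNorm_norm, eLpNorm_norm]
  have hq6 : (6 : ℝ≥0∞) = q := by rw [hq]; norm_num
  rw [hq6, mul_assoc, mul_comm K]
  refine (eLpNorm_mono_measure _ Measure.restrict_le_self).trans (h1.trans ?_)
  rw [← h2]
  gcongr
  exact h3.trans (by gcongr)

/-- The Sobolev inequality passes to `H¹`-limits of test functions. -/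
theorem eLpNorm_six_le_of_tendsto {Ω : Set Plane} {C : ℝ≥0∞} (hC : C ≠ ⊤)
    (hS : ∀ φ, IsTestFunction Ω φ →
      eLpNorm φ 6 (volume.restrict Ω) ≤ C * (eLpNorm (pderiv 0 φ) 2 (volume.restrict Ω)
        + eLpNorm (pderiv 1 φ) 2 (volume.restrict Ω)))
    {φ : ℕ → Plane → ℂ} (hφ : ∀ n, IsTestFunction Ω (φ n)) {v : Plane → ℂ} {h : Fin 2 → Plane → ℂ}
    (hv : MemLp v 2 (volume.restrict Ω)) (hh : ∀ j, MemLp (h j) 2 (volume.restrict Ω))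
    (hφv : Tendsto (fun n => eLpNorm (fun x => φ n x - v x) 2 (volume.restrict Ω)) atTop (𝓝 0))
    (hφh : ∀ j, Tendsto (fun n => eLpNorm (fun x => pderiv j (φ n) x - h j x) 2
      (volume.restrict Ω)) atTop (𝓝 0)) :
    eLpNorm v 6 (volume.restrict Ω) ≤ C * (eLpNorm (h 0) 2 (volume.restrict Ω)
      + eLpNorm (h 1) 2 (volume.restrict Ω)) := by
  have hm : ∀ n, AEStronglyMeasurable (φ n) (volume.restrict Ω) := fun n =>
    (hφ n).1.continuous.aestronglyMeasurable
  -- An almost everywhere convergent subsequence allows Fatou's lemma in `L⁶`.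
  obtain ⟨ns, hns, hae⟩ := (tendstoInMeasure_of_tendsto_eLpNorm (p := 2) (by norm_num) hm hv.1
    hφv).exists_seq_tendsto_ae
  have hg : ∀ j, Tendsto (fun n => eLpNorm (pderiv j (φ n)) 2 (volume.restrict Ω)) atTop
      (𝓝 (eLpNorm (h j) 2 (volume.restrict Ω))) := fun j =>
    tendsto_eLpNorm_of_tendsto_sub (by norm_num)
      (fun n => (((hφ n).pderiv j).memLp 2).restrict _) (hh j) (hφh j)
  have hlim : Tendsto (fun k => C * (eLpNorm (pderiv 0 (φ (ns k))) 2 (volume.restrict Ω)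
      + eLpNorm (pderiv 1 (φ (ns k))) 2 (volume.restrict Ω))) atTop
      (𝓝 (C * (eLpNorm (h 0) 2 (volume.restrict Ω) + eLpNorm (h 1) 2 (volume.restrict Ω)))) :=
    ENNReal.Tendsto.const_mul (((hg 0).add (hg 1)).comp hns.tendsto_atTop) (Or.inr hC)
  rw [← hlim.liminf_eq]
  refine (Lp.eLpNorm_lim_le_liminf_eLpNorm (fun k => hm (ns k)) v hae).trans ?_
  exact liminf_le_liminf (Eventually.of_forall fun k => hS _ (hφ _))

theorem holderTriple_six : ENNReal.HolderTriple 6 6 3 := by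
  constructor
  rw [← ENNReal.toReal_eq_toReal_iff' (by simp) (by simp),
    ENNReal.toReal_add (by simp) (by simp)]
  simp
  norm_num

/-- Factor the difference of squares and apply Hölder with `1/6 + 1/6 = 1/3`; `L⁶` convergence of
states thus yields `L³` convergence of densities. -/
theorem eLpNorm_normSq_sub_le {μ : Measure Plane} {ψ u : Plane → ℂ}
    (hψ : AEStronglyMeasurable ψ μ) (hu : AEStronglyMeasurable u μ) :
    eLpNorm (fun x => ‖ψ x‖ ^ 2 - ‖u x‖ ^ 2) 3 μ
      ≤ eLpNorm (fun x => ψ x - u x) 6 μ * (eLpNorm ψ 6 μ + eLpNorm u 6 μ) := by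
  have := holderTriple_six
  have h1 : eLpNorm (fun x => ‖ψ x‖ ^ 2 - ‖u x‖ ^ 2) 3 μ
      ≤ eLpNorm ((fun x => ‖ψ x - u x‖) • (fun x => ‖ψ x‖ + ‖u x‖)) 3 μ := by
    refine eLpNorm_mono fun x => ?_
    simp only [Pi.smul_apply', smul_eq_mul, norm_mul, norm_norm]
    rw [sq_sub_sq, norm_mul, mul_comm]
    exact mul_le_mul_of_nonneg_right (abs_norm_sub_norm_le _ _) (norm_nonneg _)
  refine h1.trans ((eLpNorm_smul_le_mul_eLpNorm (p := 6) (q := 6) (hψ.norm.add hu.norm)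
    (hψ.sub hu).norm).trans ?_)
  have h2 : eLpNorm (fun x => ‖(ψ - u) x‖) 6 μ = eLpNorm (fun x => ψ x - u x) 6 μ :=
    eLpNorm_norm _
  rw [h2]
  gcongr
  refine (eLpNorm_add_le hψ.norm hu.norm (by norm_num)).trans ?_
  rw [eLpNorm_norm, eLpNorm_norm]

theorem afEnergy_eq_sum {Ω : Set Plane} {β : ℝ} {u : Plane → ℂ} {g : Fin 2 → Plane → ℂ}
    (hF : ∀ j, AEStronglyMeasurable (fun x => -Complex.I * g j x
      + ((β * vectorPotential Ω (fun y => ‖u y‖ ^ 2) x j : ℝ) : ℂ) * u x) (volume.restrict Ω)) :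
    afEnergy Ω β u g = ∑ j : Fin 2, eLpNorm (fun x => -Complex.I * g j x
      + ((β * vectorPotential Ω (fun y => ‖u y‖ ^ 2) x j : ℝ) : ℂ) * u x) 2
        (volume.restrict Ω) ^ 2 := by
  simp only [sq_eLpNorm_two]
  rw [← lintegral_finsetSum' _ fun j _ => (hF j).enorm.pow_const 2, afEnergy]
  refine lintegral_congr fun x => ?_
  rw [ENNReal.ofReal_sum_of_nonneg fun j _ => by positivity]
  refine Finset.sum_congr rfl fun j _ => ?_
  rw [ENNReal.ofReal_pow (norm_nonneg _), ofReal_norm]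

theorem memLp_normSq_three {μ : Measure Plane} {u : Plane → ℂ} (hu : MemLp u 6 μ) :
    MemLp (fun x => ‖u x‖ ^ 2) 3 μ := by
  refine ⟨hu.1.norm.pow 2, ?_⟩
  have := eLpNorm_normSq_sub_le hu.1 (aestronglyMeasurable_zero (α := Plane) (β := ℂ) (μ := μ))
  simp only [Pi.zero_apply, norm_zero, ne_eq, OfNat.ofNat_ne_zero, not_false_eq_true, zero_pow,
    sub_zero, eLpNorm_zero, add_zero] at this
  exact this.trans_lt (ENNReal.mul_lt_top hu.2 hu.2)

section

variable {Ω : Set Plane} {R : ℝ}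

theorem aestronglyMeasurable_potential_mul {σ : Plane → ℝ} {v : Plane → ℂ}
    (hσ : AEStronglyMeasurable σ (volume.restrict Ω))
    (hv : AEStronglyMeasurable v (volume.restrict Ω)) (β : ℝ) (j : Fin 2) :
    AEStronglyMeasurable (fun x => ((β * vectorPotential Ω σ x j : ℝ) : ℂ) * v x)
      (volume.restrict Ω) := by
  have h1 := (EuclideanSpace.proj (𝕜 := ℝ) j).continuous.comp_aestronglyMeasurable
    ((aestronglyMeasurable_vectorPotential hσ).restrict (s := Ω))
  exact (Complex.continuous_ofReal.comp_aestronglyMeasurable (h1.const_mul β)).mul hv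

theorem eLpNorm_potential_mul_le (hΩ : MeasurableSet Ω) (hR : Ω ⊆ Metric.ball 0 R) {σ : Plane → ℝ}
    {v : Plane → ℂ} (hσ : AEStronglyMeasurable σ (volume.restrict Ω))
    (hv : AEStronglyMeasurable v (volume.restrict Ω)) (β : ℝ) (j : Fin 2) :
    eLpNorm (fun x => ((β * vectorPotential Ω σ x j : ℝ) : ℂ) * v x) 2 (volume.restrict Ω)
      ≤ ‖β‖ₑ * (eLpNorm σ 3 (volume.restrict Ω) * kernelBound R)
        * eLpNorm v 2 (volume.restrict Ω) := by
  refine eLpNorm_le_mul_eLpNorm_of_ae_le_mul'' 2 hv ?_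
  filter_upwards [ae_restrict_mem hΩ] with x hx
  rw [enorm_mul]
  gcongr
  have h1 : ‖((β * vectorPotential Ω σ x j : ℝ) : ℂ)‖ₑ = ‖β‖ₑ * ‖vectorPotential Ω σ x j‖ₑ := by
    rw [← enorm_mul, ← ofReal_norm, ← ofReal_norm, Complex.norm_real]
  rw [h1]
  gcongr
  refine le_trans ?_ (enorm_vectorPotential_le hR (hR hx) hσ)
  rw [← ofReal_norm, ← ofReal_norm]
  exact ENNReal.ofReal_le_ofReal (PiLp.norm_apply_le _ j)

theorem vectorPotential_sub (hR : Ω ⊆ Metric.ball 0 R) {σ τ : Plane → ℝ}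
    (hσ : MemLp σ 3 (volume.restrict Ω)) (hτ : MemLp τ 3 (volume.restrict Ω)) {x : Plane}
    (hx : x ∈ Ω) :
    vectorPotential Ω (fun y => σ y - τ y) x = vectorPotential Ω σ x - vectorPotential Ω τ x := by
  simp only [vectorPotential, sub_smul]
  exact integral_sub (integrable_kernel_smul hR (hR hx) hσ) (integrable_kernel_smul hR (hR hx) hτ)

/-- The average-field energy is continuous along sequences that converge in `H¹ ∩ L⁶`. -/
theorem tendsto_afEnergy (hΩ : MeasurableSet Ω) (hR : Ω ⊆ Metric.ball 0 R) (β : ℝ)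
    {u : Plane → ℂ} {g : Fin 2 → Plane → ℂ} {ψ : ℕ → Plane → ℂ} {h : ℕ → Fin 2 → Plane → ℂ}
    (hu : MemLp u 2 (volume.restrict Ω)) (hg : ∀ j, MemLp (g j) 2 (volume.restrict Ω))
    (hu6 : MemLp u 6 (volume.restrict Ω))
    (hψ : ∀ n, MemLp (ψ n) 2 (volume.restrict Ω)) (hψ6 : ∀ n, MemLp (ψ n) 6 (volume.restrict Ω))
    (hh : ∀ n j, MemLp (h n j) 2 (volume.restrict Ω))
    (lim2 : Tendsto (fun n => eLpNorm (fun x => ψ n x - u x) 2 (volume.restrict Ω)) atTop (𝓝 0))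
    (lim6 : Tendsto (fun n => eLpNorm (fun x => ψ n x - u x) 6 (volume.restrict Ω)) atTop (𝓝 0))
    (limg : ∀ j, Tendsto (fun n => eLpNorm (fun x => h n j x - g j x) 2 (volume.restrict Ω))
      atTop (𝓝 0)) :
    Tendsto (fun n => afEnergy Ω β (ψ n) (h n)) atTop (𝓝 (afEnergy Ω β u g)) := by
  set μ := volume.restrict Ω with hμ
  have hϱ := memLp_normSq_three hu6
  have hϱn := fun n => memLp_normSq_three (hψ6 n)
  have hk : kernelBound R ≠ ⊤ := (kernelBound_lt_top R).ne
  have mem : ∀ {v : Plane → ℂ} {f : Plane → ℂ} (j : Fin 2), MemLp v 2 μ → MemLp v 6 μ →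
      MemLp f 2 μ → MemLp (fun x => -Complex.I * f x
        + ((β * vectorPotential Ω (fun y => ‖v y‖ ^ 2) x j : ℝ) : ℂ) * v x) 2 μ := by
    intro v f j hv hv6 hf
    refine (hf.const_mul (-Complex.I)).add
      ⟨aestronglyMeasurable_potential_mul (memLp_normSq_three hv6).1 hv.1 β j, ?_⟩
    refine (eLpNorm_potential_mul_le hΩ hR (memLp_normSq_three hv6).1 hv.1 β j).trans_lt ?_
    exact ENNReal.mul_lt_top (ENNReal.mul_lt_top (by simp)
      (ENNReal.mul_lt_top (memLp_normSq_three hv6).2 hk.lt_top)) hv.2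
  have lim3 : Tendsto (fun n => eLpNorm (fun x => ‖ψ n x‖ ^ 2 - ‖u x‖ ^ 2) 3 μ) atTop (𝓝 0) := by
    have h6 := tendsto_eLpNorm_of_tendsto_sub (by norm_num) hψ6 hu6 lim6
    have hlim := ENNReal.Tendsto.mul lim6 (Or.inr (ENNReal.add_ne_top.2 ⟨hu6.2.ne, hu6.2.ne⟩))
      (h6.add (tendsto_const_nhds (x := eLpNorm u 6 μ))) (Or.inr ENNReal.zero_ne_top)
    rw [zero_mul] at hlim
    exact tendsto_of_tendsto_of_tendsto_of_le_of_le tendsto_const_nhds hlim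
      (fun _ => zero_le) fun n => eLpNorm_normSq_sub_le (hψ n).1 hu.1
  have limϱ := tendsto_eLpNorm_of_tendsto_sub (by norm_num) hϱn hϱ lim3
  have key : ∀ j, Tendsto (fun n => eLpNorm (fun x => -Complex.I * h n j x
      + ((β * vectorPotential Ω (fun y => ‖ψ n y‖ ^ 2) x j : ℝ) : ℂ) * ψ n x) 2 μ) atTop
      (𝓝 (eLpNorm (fun x => -Complex.I * g j x
      + ((β * vectorPotential Ω (fun y => ‖u y‖ ^ 2) x j : ℝ) : ℂ) * u x) 2 μ)) := by
    intro j
    refine tendsto_eLpNorm_of_tendsto_sub (by norm_num)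
      (fun n => mem j (hψ n) (hψ6 n) (hh n j)) (mem j hu hu6 (hg j)) ?_
    have hlim : Tendsto (fun n => eLpNorm (fun x => h n j x - g j x) 2 μ
        + ‖β‖ₑ * (eLpNorm (fun y => ‖ψ n y‖ ^ 2) 3 μ * kernelBound R)
          * eLpNorm (fun x => ψ n x - u x) 2 μ
        + ‖β‖ₑ * (eLpNorm (fun y => ‖ψ n y‖ ^ 2 - ‖u y‖ ^ 2) 3 μ * kernelBound R)
          * eLpNorm u 2 μ) atTop (𝓝 0) := by
      have hb : ‖β‖ₑ ≠ ⊤ := by simp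
      have l1 := ENNReal.Tendsto.mul
        (ENNReal.Tendsto.const_mul (ENNReal.Tendsto.mul_const limϱ (Or.inr hk)) (Or.inr hb))
        (Or.inr ENNReal.zero_ne_top) lim2
        (Or.inr (ENNReal.mul_ne_top hb (ENNReal.mul_ne_top hϱ.2.ne hk)))
      have l2 := ENNReal.Tendsto.mul_const
        (ENNReal.Tendsto.const_mul (ENNReal.Tendsto.mul_const lim3 (Or.inr hk)) (Or.inr hb))
        (b := eLpNorm u 2 μ) (Or.inr hu.2.ne)
      simpa using ((limg j).add l1).add l2
    refine tendsto_of_tendsto_of_tendsto_of_le_of_le tendsto_const_nhds hlim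
      (fun _ => zero_le) fun n => ?_
    -- The cubic term is split by changing the state first and the density second, so each piece
    -- contains one factor tending to zero.
    have hdec : (fun x => (-Complex.I * h n j x
        + ((β * vectorPotential Ω (fun y => ‖ψ n y‖ ^ 2) x j : ℝ) : ℂ) * ψ n x)
        - (-Complex.I * g j x
          + ((β * vectorPotential Ω (fun y => ‖u y‖ ^ 2) x j : ℝ) : ℂ) * u x)) =ᵐ[μ]
        (((-Complex.I) • fun x => h n j x - g j x)
        + fun x => ((β * vectorPotential Ω (fun y => ‖ψ n y‖ ^ 2) x j : ℝ) : ℂ) * (ψ n x - u x))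
        + fun x => ((β * vectorPotential Ω (fun y => ‖ψ n y‖ ^ 2 - ‖u y‖ ^ 2) x j : ℝ) : ℂ)
          * u x := by
      filter_upwards [ae_restrict_mem hΩ] with x hx
      simp only [Pi.add_apply, Pi.smul_apply, smul_eq_mul,
        vectorPotential_sub hR (hϱn n) hϱ hx, PiLp.sub_apply]
      push_cast
      ring
    have m1 : AEStronglyMeasurable ((-Complex.I) • fun x => h n j x - g j x) μ :=
      (((hh n j).sub (hg j)).const_smul _).1
    have m2 : AEStronglyMeasurable (fun x => ψ n x - u x) μ := ((hψ n).sub hu).1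
    have m3 := aestronglyMeasurable_potential_mul (hϱn n).1 m2 β j
    have m4 := aestronglyMeasurable_potential_mul ((hϱn n).sub hϱ).1 hu.1 β j
    rw [eLpNorm_congr_ae hdec]
    refine (eLpNorm_add_le (m1.add m3) m4 (by norm_num)).trans ?_
    refine add_le_add ((eLpNorm_add_le m1 m3 (by norm_num)).trans (add_le_add ?_ ?_)) ?_
    · have hI : ‖Complex.I‖ₑ = 1 := by rw [← ofReal_norm]; simp
      rw [eLpNorm_const_smul, enorm_neg, hI, one_mul]
    · exact eLpNorm_potential_mul_le hΩ hR (hϱn n).1 m2 β j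
    · exact eLpNorm_potential_mul_le hΩ hR ((hϱn n).sub hϱ).1 hu.1 β j
  rw [afEnergy_eq_sum fun j => (mem j hu hu6 (hg j)).1]
  simp only [afEnergy_eq_sum fun j => (mem j (hψ _) (hψ6 _) (hh _ j)).1]
  exact tendsto_finsetSum _ fun j _ => (ENNReal.continuous_pow 2).tendsto _ |>.comp (key j)

/-- Trial states in `H¹₀` are approximated in energy by test functions of the same mass. -/
theorem IsH10.exists_approx (hΩ : MeasurableSet Ω) (hb : Bornology.IsBounded Ω) {β M : ℝ}
    {u : Plane → ℂ} {g : Fin 2 → Plane → ℂ} (hu : IsH10 Ω u g) (hM : 0 < M)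
    (hm : ∫ x in Ω, ‖u x‖ ^ 2 = M) :
    ∃ ψ : ℕ → Plane → ℂ, (∀ n, IsTestFunction Ω (ψ n) ∧ ∫ x, ‖ψ n x‖ ^ 2 = M) ∧
      Tendsto (fun n => ENNReal.ofReal (magEnergy β (ψ n))) atTop (𝓝 (afEnergy Ω β u g)) := by
  obtain ⟨R, hR⟩ := hb.subset_ball 0
  obtain ⟨C, hC, hS⟩ := exists_sobolev_const hb
  obtain ⟨φ, hφ, lim2, limg⟩ := hu.approx
  have hφm : ∀ n, MemLp (φ n) 2 (volume.restrict Ω) := fun n => ((hφ n).memLp 2).restrict _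
  have hφg : ∀ n j, MemLp (pderiv j (φ n)) 2 (volume.restrict Ω) :=
    fun n j => (((hφ n).pderiv j).memLp 2).restrict _
  have hφ6 : ∀ n, MemLp (φ n) 6 (volume.restrict Ω) := fun n => ((hφ n).memLp 6).restrict _
  have hu6 : MemLp u 6 (volume.restrict Ω) := by
    refine ⟨hu.memLp.1, (eLpNorm_six_le_of_tendsto hC hS hφ hu.memLp hu.memLp_grad lim2
      limg).trans_lt ?_⟩
    exact ENNReal.mul_lt_top hC.lt_top
      (ENNReal.add_lt_top.2 ⟨(hu.memLp_grad 0).2, (hu.memLp_grad 1).2⟩)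
  have hmul : ∀ (c : ℂ) {f : Plane → ℂ} (_ : IsTestFunction Ω f) j,
      pderiv j (fun x => c * f x) = fun x => c * pderiv j f x :=
    fun c f hf j => funext fun x => hf.pderiv_const_mul c j x
  have hsub : ∀ n m, IsTestFunction Ω (fun x => φ n x + (-1 : ℂ) * φ m x) := fun n m =>
    (hφ n).add ((hφ m).const_mul (-1))
  have hsubd : ∀ n m j, pderiv j (fun x => φ n x + (-1 : ℂ) * φ m x)
      = fun x => pderiv j (φ n) x + (-1 : ℂ) * pderiv j (φ m) x := by
    intro n m j
    funext x
    have := ((hφ n).1.differentiable (by simp) x).hasFDerivAt.add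
      (((hφ m).const_mul (-1)).1.differentiable (by simp) x).hasFDerivAt
    refine (pderiv_apply_eq this j).trans ?_
    rw [← (hφ m).pderiv_const_mul]
    rfl
  have tail : ∀ {p : ℝ≥0∞} {F : ℕ → Plane → ℂ} {f : Plane → ℂ} (n : ℕ),
      Tendsto (fun m => eLpNorm (fun x => F m x - f x) p (volume.restrict Ω)) atTop (𝓝 0) →
      Tendsto (fun m => eLpNorm (fun x => (F n x + (-1 : ℂ) * F m x) - (F n x - f x)) p
        (volume.restrict Ω)) atTop (𝓝 0) := by
    intro p F f n hF
    refine hF.congr fun m => ?_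
    rw [← eLpNorm_neg]
    congr 1
    funext x
    simp
    ring
  have lim6 : Tendsto (fun n => eLpNorm (fun x => φ n x - u x) 6 (volume.restrict Ω)) atTop
      (𝓝 0) := by
    -- For fixed `n`, the difference `φ n - u` is itself the limit of the test functions `φ n - φ m`
    -- as `m → ∞`, so the Sobolev bound applies to it.
    have hle : ∀ n, eLpNorm (fun x => φ n x - u x) 6 (volume.restrict Ω)
        ≤ C * (eLpNorm (fun x => pderiv 0 (φ n) x - g 0 x) 2 (volume.restrict Ω)
          + eLpNorm (fun x => pderiv 1 (φ n) x - g 1 x) 2 (volume.restrict Ω)) := by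
      intro n
      refine eLpNorm_six_le_of_tendsto hC hS (h := fun j x => pderiv j (φ n) x - g j x)
        (hsub n) ((hφm n).sub hu.memLp) (fun j => (hφg n j).sub (hu.memLp_grad j))
        (tail n lim2) fun j => ?_
      simp only [hsubd]
      exact tail (F := fun m => pderiv j (φ m)) n (limg j)
    have hlim := ENNReal.Tendsto.const_mul ((limg 0).add (limg 1)) (a := C) (Or.inr hC)
    rw [add_zero, mul_zero] at hlim
    exact tendsto_of_tendsto_of_tendsto_of_le_of_le tendsto_const_nhds hlim
      (fun _ => zero_le) hle
  set m : ℕ → ℝ := fun n => ∫ x, ‖φ n x‖ ^ 2 with hmdef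
  have hmlim : Tendsto m atTop (𝓝 M) := by
    have h1 := tendsto_eLpNorm_of_tendsto_sub (by norm_num) hφm hu.memLp lim2
    have h2 := ((ENNReal.tendsto_toReal hu.memLp.2.ne).comp h1).pow 2
    rw [← integral_norm_sq_eq hu.memLp, hm] at h2
    refine h2.congr fun n => ?_
    simp only [Function.comp_apply]
    rw [← integral_norm_sq_eq (hφm n), (hφ n).setIntegral_eq (by simp +contextual)]
  -- Beyond `N` the masses are positive, so each state can be rescaled to mass exactly `M`; this is
  -- where `M > 0` enters.
  obtain ⟨N, hN⟩ := eventually_atTop.1 (hmlim.eventually (lt_mem_nhds hM))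
  set c : ℕ → ℝ := fun n => Real.sqrt (M / m (n + N)) with hcdef
  have hc : Tendsto c atTop (𝓝 1) := by
    have h1 : Tendsto (fun n => M / m (n + N)) atTop (𝓝 (M / M)) :=
      tendsto_const_nhds.div (hmlim.comp (tendsto_add_atTop_nat N)) hM.ne'
    rw [div_self hM.ne'] at h1
    have h2 := (Real.continuous_sqrt.tendsto 1).comp h1
    rwa [Real.sqrt_one] at h2
  have hshift : ∀ {f : ℕ → ℝ≥0∞}, Tendsto f atTop (𝓝 0) →
      Tendsto (fun n => f (n + N)) atTop (𝓝 0) := fun h => h.comp (tendsto_add_atTop_nat N)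
  have hψ : ∀ n, IsTestFunction Ω (fun x => (c n : ℂ) * φ (n + N) x) :=
    fun n => (hφ (n + N)).const_mul _
  refine ⟨fun n x => (c n : ℂ) * φ (n + N) x, fun n => ⟨hψ n, ?_⟩, ?_⟩
  · have hpos : 0 < m (n + N) := hN _ (Nat.le_add_left _ _)
    rw [IsTestFunction.integral_normSq_const_mul, Real.sq_sqrt (by positivity)]
    exact div_mul_cancel₀ _ hpos.ne'
  · simp only [← (hψ _).afEnergy_eq hΩ β]
    refine tendsto_afEnergy hΩ hR β hu.memLp hu.memLp_grad hu6
      (fun n => ((hψ n).memLp 2).restrict _) (fun n => ((hψ n).memLp 6).restrict _)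
      (fun n j => (((hψ n).pderiv j).memLp 2).restrict _)
      (tendsto_eLpNorm_mul_sub (by norm_num) (fun n => hφm (n + N)) hu.memLp hc (hshift lim2))
      (tendsto_eLpNorm_mul_sub (by norm_num) (fun n => hφ6 (n + N)) hu6 hc (hshift lim6))
      fun j => ?_
    simp only [hmul _ (hφ _)]
    exact tendsto_eLpNorm_mul_sub (by norm_num) (fun n => hφg (n + N) j) (hu.memLp_grad j) hc
      (hshift (limg j))

end

/-! ### The energy of the unit square at large coupling. -/

theorem volume_openBox_one : volume (openBox 1 1) = 1 := by
  have hm : MeasurableSet (openBox 1 1) := by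
    have h : openBox 1 1 = {x : Plane | 0 < x 0} ∩ {x | x 0 < 1} ∩
        ({x | 0 < x 1} ∩ {x | x 1 < 1}) := rfl
    rw [h]
    measurability
  rw [← measurePreserving_toPlane.measure_preimage hm.nullMeasurableSet]
  have h : (fun p : ℝ × ℝ => (!₂[p.1, p.2] : Plane)) ⁻¹' openBox 1 1
      = Set.Ioo 0 1 ×ˢ Set.Ioo 0 1 := by
    ext p
    simp [openBox]
  rw [h, Measure.volume_eq_prod, Measure.prod_prod]
  simp

theorem HasTrial.two_pi_mul_le {β e : ℝ} (hβ : 0 ≤ β) (h : HasTrial β 1 1 1 e) :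
    2 * Real.pi * β ≤ e := by
  obtain ⟨u, hu, hm, rfl⟩ := h
  have h4 : 1 ≤ ∫ x, ‖u x‖ ^ 4 := by
    have hi2 : Integrable (fun x => ‖u x‖ ^ 2) (volume.restrict (openBox 1 1)) :=
      ((memLp_one_iff_integrable.1 (hu.memLp_normSq 1))).restrict
    have hi4 : Integrable (fun x => ‖u x‖ ^ 4) (volume.restrict (openBox 1 1)) := by
      have := (memLp_two_iff_integrable_sq (hu.memLp_normSq 2).1).1 (hu.memLp_normSq 2)
      refine (this.congr (ae_of_all _ fun x => ?_)).restrict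
      simp only
      ring
    have : IsFiniteMeasure (volume.restrict (openBox 1 1)) :=
      ⟨by rw [Measure.restrict_apply_univ, volume_openBox_one]; exact ENNReal.one_lt_top⟩
    -- On a set of area one, `2|u|² ≤ |u|⁴ + 1` with `∫|u|² = 1` replaces Cauchy–Schwarz.
    have hmono := integral_mono (hi2.const_mul 2)
      (hi4.add (integrable_const (1 : ℝ))) fun x => by
        simp only [Pi.add_apply]
        nlinarith [sq_nonneg (‖u x‖ ^ 2 - 1)]
    rw [integral_const_mul, integral_add' hi4 (integrable_const _),
      hu.setIntegral_eq (by simp +contextual), hu.setIntegral_eq (by simp +contextual), hm] at hmono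
    simp [Measure.real, volume_openBox_one] at hmono
    linarith
  refine le_trans ?_ (hu.le_magEnergy β)
  exact le_mul_of_one_le_right (by positivity) h4

theorem exists_hasTrial (β : ℝ) : ∃ e, HasTrial β 1 1 1 e := by
  let c : Plane := !₂[1 / 2, 1 / 2]
  let f : ContDiffBump c := ⟨1 / 8, 1 / 4, by norm_num, by norm_num⟩
  have hsub : Metric.closedBall c (1 / 4) ⊆ openBox 1 1 := by
    intro x hx
    rw [mem_closedBall_iff_norm] at hx
    have h0 := abs_le.1 ((PiLp.norm_apply_le (x - c) 0).trans hx)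
    have h1 := abs_le.1 ((PiLp.norm_apply_le (x - c) 1).trans hx)
    simp [c] at h0 h1
    exact ⟨⟨by linarith [h0.1], by linarith [h0.2]⟩, by linarith [h1.1], by linarith [h1.2]⟩
  have hf : IsTestFunction (openBox 1 1) (fun x => (f x : ℂ)) := by
    refine ⟨Complex.ofRealCLM.contDiff.comp f.contDiff,
      f.hasCompactSupport.comp_left (g := fun t : ℝ => (t : ℂ)) (by simp), ?_⟩
    refine Set.Subset.trans (closure_mono ?_) ((f.tsupport_eq).le.trans hsub)
    intro x hx h0
    exact hx (by simp [h0])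
  have hpos : 0 < ∫ x, ‖(f x : ℂ)‖ ^ 2 := by
    refine hf.normSq.1.continuous.integral_pos_of_hasCompactSupport_nonneg_nonzero hf.normSq.2
      (fun x => by positivity) (x := c) ?_
    simp [f.one_of_mem_closedBall (Metric.mem_closedBall_self f.rIn_pos.le)]
  set m := ∫ x, ‖(f x : ℂ)‖ ^ 2
  refine ⟨_, fun x => ((Real.sqrt m⁻¹ : ℝ) : ℂ) * f x, hf.const_mul _, ?_, rfl⟩
  rw [IsTestFunction.integral_normSq_const_mul, Real.sq_sqrt (by positivity)]
  exact inv_mul_cancel₀ hpos.ne'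

/-- The infimum of the energy over test functions of mass one in the unit square. -/
noncomputable def unitEnergy (β : ℝ) : ℝ := sInf {e | HasTrial β 1 1 1 e}

theorem unitEnergy_le {β e : ℝ} (h : HasTrial β 1 1 1 e) : unitEnergy β ≤ e := by
  refine csInf_le ⟨0, ?_⟩ h
  rintro _ ⟨u, -, -, rfl⟩
  exact magEnergy_nonneg β u

theorem two_pi_mul_le_unitEnergy {β : ℝ} (hβ : 0 ≤ β) : 2 * Real.pi * β ≤ unitEnergy β :=
  le_csInf (exists_hasTrial β) fun _ h => h.two_pi_mul_le hβ

/-- The large-coupling limit of `unitEnergy β / β`. -/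
noncomputable def unitEnergyLimit : ℝ := sInf ((fun b => unitEnergy b / b) '' Set.Ioi 0)

theorem two_pi_le_div {b : ℝ} (hb : 0 < b) : 2 * Real.pi ≤ unitEnergy b / b :=
  (le_div_iff₀ hb).2 (two_pi_mul_le_unitEnergy hb.le)

theorem two_pi_le_unitEnergyLimit : 2 * Real.pi ≤ unitEnergyLimit := by
  refine le_csInf ⟨_, 1, Set.mem_Ioi.2 one_pos, rfl⟩ ?_
  rintro _ ⟨b, hb, rfl⟩
  exact two_pi_le_div hb

theorem unitEnergyLimit_le {b : ℝ} (hb : 0 < b) : unitEnergyLimit ≤ unitEnergy b / b := by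
  refine csInf_le ⟨2 * Real.pi, ?_⟩ ⟨b, hb, rfl⟩
  rintro _ ⟨b, hb, rfl⟩
  exact two_pi_le_div hb

/-- A large coupling `B` is distributed over `n²` tiles with `n = ⌊√(B/b)⌋`; each tile carries
coupling `B / n²`, close to `b`. -/
theorem tendsto_div_floor_sqrt_sq {b : ℝ} (hb : 0 < b) :
    Tendsto (fun B : ℝ => B / (⌊Real.sqrt (B / b)⌋₊ : ℝ) ^ 2) atTop (𝓝 b) := by
  have hx : Tendsto (fun B : ℝ => Real.sqrt (B / b)) atTop atTop :=
    Real.tendsto_sqrt_atTop.comp (tendsto_id.atTop_div_const hb)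
  have h1 := ((tendsto_nat_floor_div_atTop (R := ℝ)).comp hx).inv₀ one_ne_zero
  have h2 := (h1.pow 2).const_mul b
  rw [inv_one, one_pow, mul_one] at h2
  refine h2.congr' ?_
  filter_upwards [eventually_gt_atTop 0] with B hB
  have hsq := Real.sq_sqrt (div_pos hB hb).le
  simp only [Function.comp_apply, inv_div, div_pow, hsq]
  field_simp

theorem tendsto_unitEnergy_div : Tendsto (fun b => unitEnergy b / b) atTop (𝓝 unitEnergyLimit) := by
  refine tendsto_order.2 ⟨fun l hl => ?_, fun l hl => ?_⟩
  · filter_upwards [eventually_gt_atTop 0] with b hb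
    exact hl.trans_le (unitEnergyLimit_le hb)
  · obtain ⟨_, ⟨b, hb, rfl⟩, hbl⟩ :=
      exists_lt_of_csInf_lt (Set.nonempty_Ioi.image _) hl
    have hb' : 0 < b := hb
    obtain ⟨_, ⟨u, hu, hm, rfl⟩, hul⟩ :=
      exists_lt_of_csInf_lt (exists_hasTrial b) ((div_lt_iff₀ hb').1 hbl)
    -- The near-minimiser `u` for `b` is kept fixed while the coupling moves to `B / n²`, so no
    -- continuity of `unitEnergy` is needed.
    have hcont : Tendsto (fun b' => magEnergy b' u / b') (𝓝 b) (𝓝 (magEnergy b u / b)) :=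
      (hu.continuous_magEnergy.tendsto b).div tendsto_id hb'.ne'
    have hev := (hcont.comp (tendsto_div_floor_sqrt_sq hb')).eventually
      (gt_mem_nhds ((div_lt_iff₀ hb').2 hul))
    filter_upwards [hev, eventually_ge_atTop b] with B hB hBb
    have hBpos : 0 < B := hb'.trans_le hBb
    set n := ⌊Real.sqrt (B / b)⌋₊ with hn
    have hn0 : n ≠ 0 := by
      have : 1 ≤ n := Nat.le_floor (by
        rw [Nat.cast_one, Real.one_le_sqrt]
        exact (one_le_div hb').2 hBb)
      omega
    have hnpos : (0 : ℝ) < n := by positivity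
    have ht := HasTrial.tile (β := B / (n : ℝ) ^ 2) ⟨u, hu, hm, rfl⟩ hn0
    rw [mul_div_cancel₀ _ (by positivity : (n : ℝ) ^ 2 ≠ 0)] at ht
    refine lt_of_le_of_lt ?_ hB
    simp only [Function.comp_apply]
    rw [div_div_eq_mul_div, mul_comm]
    exact div_le_div_of_nonneg_right (unitEnergy_le ht) hBpos.le

/-! ### Scaled squares and the thermodynamic limit. -/

section Square

variable {Q : Set Plane} {L : ℝ}

theorem unitSquare_eq : {x : Plane | ∀ i, 0 < x i ∧ x i < 1} = openBox 1 1 := by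
  ext x
  simp [openBox, Fin.forall_fin_two]

theorem isBounded_openBox : Bornology.IsBounded (openBox 1 1) := by
  refine Metric.isBounded_ball.subset (t := Metric.ball 0 2) fun x hx => ?_
  obtain ⟨⟨h1, h2⟩, h3, h4⟩ := hx
  rw [mem_ball_zero_iff]
  refine lt_of_pow_lt_pow_left₀ 2 (by norm_num) ?_
  rw [plane_norm_sq]
  nlinarith

theorem isOpen_openBox : IsOpen (openBox 1 1) := by
  have h0 : Continuous fun x : Plane => x 0 := by fun_prop
  have h1 : Continuous fun x : Plane => x 1 := by fun_prop
  exact ((isOpen_lt continuous_const h0).inter (isOpen_lt h0 continuous_const)).inter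
    ((isOpen_lt continuous_const h1).inter (isOpen_lt h1 continuous_const))

/-- A scaled unit square and the unit square are preimages of each other under similarities. -/
theorem IsUnitSquare.exists_similarity (hQ : IsUnitSquare Q) (hL : 0 < L) :
    ∃ (R : Plane ≃ₗᵢ[ℝ] Plane) (t s : Plane),
      L • Q = similarity L⁻¹ R.symm t ⁻¹' openBox 1 1 ∧
      openBox 1 1 = similarity L R s ⁻¹' (L • Q) := by
  obtain ⟨f, rfl⟩ := hQ
  rw [unitSquare_eq]
  have hf : ∀ x, f x = f.linearIsometryEquiv x + f 0 := fun x => by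
    have := f.map_vadd 0 x
    simpa using this
  have h1 : ∀ x, similarity L f.linearIsometryEquiv (L • f 0) x = L • f x := fun x => by
    rw [hf x, smul_add]; rfl
  have h2 : ∀ x, similarity L⁻¹ f.linearIsometryEquiv.symm
      (-f.linearIsometryEquiv.symm (f 0)) (L • f x) = x := fun x => by
    rw [hf x, similarity, map_smul, smul_smul, inv_mul_cancel₀ hL.ne', one_smul, map_add,
      LinearIsometryEquiv.symm_apply_apply, add_neg_cancel_right]
  have hsurj : ∀ y, ∃ x, y = L • f x := fun y =>
    ⟨f.symm (L⁻¹ • y), by simp [smul_smul, hL.ne']⟩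
  have hmem : ∀ x, L • f x ∈ L • (f '' openBox 1 1) ↔ x ∈ openBox 1 1 := fun x => by
    rw [Set.smul_mem_smul_set_iff₀ hL.ne', f.injective.mem_set_image]
  refine ⟨f.linearIsometryEquiv, -f.linearIsometryEquiv.symm (f 0), L • f 0, ?_, ?_⟩
  · ext y
    obtain ⟨x, rfl⟩ := hsurj y
    rw [hmem, Set.mem_preimage, h2]
  · ext x
    rw [Set.mem_preimage, h1, hmem]

theorem IsUnitSquare.isBounded (hQ : IsUnitSquare Q) : Bornology.IsBounded (L • Q) := by
  obtain ⟨f, rfl⟩ := hQ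
  rw [unitSquare_eq]
  exact (f.isometry.lipschitz.isBounded_image isBounded_openBox).smul₀ L

theorem IsUnitSquare.measurableSet (hQ : IsUnitSquare Q) (hL : 0 < L) :
    MeasurableSet (L • Q) := by
  obtain ⟨R, t, s, h1, -⟩ := hQ.exists_similarity hL
  rw [h1]
  exact (isOpen_openBox.preimage
    ((R.symm.continuous.const_smul L⁻¹).add continuous_const)).measurableSet

/-- Dilation by `L` turns `β` into `β L²`, and normalising the mass by the amplitude `√ρ`
contributes another factor `ρ` to the coupling and one in front. -/
theorem dirichletEnergy_eq (hQ : IsUnitSquare Q) (hL : 0 < L) (β : ℝ) {ρ : ℝ} (hρ : 0 < ρ) :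
    dirichletEnergy (L • Q) β (ρ * L ^ 2) = ENNReal.ofReal (ρ * unitEnergy (β * ρ * L ^ 2)) := by
  obtain ⟨R, t, s, h1, h2⟩ := hQ.exists_similarity hL
  have hmeas := hQ.measurableSet hL
  refine le_antisymm ?_ ?_
  · have key : ∀ e, HasTrial (β * ρ * L ^ 2) 1 1 1 e →
        dirichletEnergy (L • Q) β (ρ * L ^ 2) ≤ ENNReal.ofReal (ρ * e) := by
      rintro _ ⟨u, hu, hm, rfl⟩
      obtain ⟨v, hv, hvm, hve⟩ := (hu.const_mul (Real.sqrt ρ : ℝ)).exists_transport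
        (inv_pos.2 hL) R.symm t β
      rw [← h1] at hv
      rw [IsTestFunction.integral_normSq_const_mul, hm, Real.sq_sqrt hρ.le] at hvm
      rw [hu.magEnergy_const_mul, Real.sq_sqrt hρ.le] at hve
      refine sInf_le ⟨v, fun j => pderiv j v, hv.isH10, ?_, ?_⟩
      · rw [hv.setIntegral_eq (by simp +contextual), hvm]
        field_simp
      · rw [hv.afEnergy_eq hmeas, hve]
        congr 3
        field_simp
    obtain ⟨e, he⟩ := exists_hasTrial (β * ρ * L ^ 2)
    have hfin : dirichletEnergy (L • Q) β (ρ * L ^ 2) ≠ ⊤ :=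
      ((key e he).trans_lt ENNReal.ofReal_lt_top).ne
    rw [← ENNReal.ofReal_toReal hfin]
    refine ENNReal.ofReal_le_ofReal ?_
    rw [← div_le_iff₀' hρ]
    refine le_csInf ⟨e, he⟩ fun e' he' => ?_
    rw [div_le_iff₀' hρ]
    have h0 : 0 ≤ e' := by
      obtain ⟨u, -, -, rfl⟩ := he'
      exact magEnergy_nonneg _ u
    have := ENNReal.toReal_mono ENNReal.ofReal_ne_top (key e' he')
    rwa [ENNReal.toReal_ofReal (by positivity)] at this
  · refine le_sInf ?_
    rintro _ ⟨u, g, hu, hm, rfl⟩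
    obtain ⟨ψ, hψ, hlim⟩ := hu.exists_approx (β := β) hmeas hQ.isBounded (by positivity) hm
    refine ge_of_tendsto' hlim fun n => ENNReal.ofReal_le_ofReal ?_
    obtain ⟨v, hv, hvm, hve⟩ := (hψ n).1.exists_transport hL R s (β * L ^ 2)
    rw [← h2] at hv
    rw [(hψ n).2] at hvm
    rw [mul_div_cancel_right₀ _ (by positivity)] at hve
    have hsq : Real.sqrt ρ⁻¹ ^ 2 = ρ⁻¹ := Real.sq_sqrt (by positivity)
    rw [← le_div_iff₀' hρ]
    refine unitEnergy_le ⟨_, hv.const_mul (Real.sqrt ρ⁻¹ : ℝ), ?_, ?_⟩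
    · rw [IsTestFunction.integral_normSq_const_mul, hvm, hsq]
      field_simp
    · rw [hv.magEnergy_const_mul, hsq, ← hve, div_eq_inv_mul]
      congr 2
      field_simp

theorem dirichletEnergy_zero {Ω : Set Plane} (hΩ : MeasurableSet Ω) (β : ℝ) :
    dirichletEnergy Ω β 0 = 0 := by
  have h0 : IsTestFunction Ω fun _ => 0 := ⟨contDiff_const, HasCompactSupport.zero, by simp⟩
  refine le_antisymm (sInf_le ⟨_, _, h0.isH10, by simp, ?_⟩) zero_le
  rw [h0.afEnergy_eq hΩ]
  simp [magEnergy, magField, pderiv]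

theorem tendsto_dirichletEnergy (hQ : IsUnitSquare Q) {β ρ : ℝ} (hβ : 0 ≤ β) (hρ : 0 ≤ ρ) :
    Tendsto (fun L : ℝ => dirichletEnergy (L • Q) β (ρ * L ^ 2) / ENNReal.ofReal (L ^ 2))
      atTop (𝓝 (ENNReal.ofReal (β * ρ ^ 2 * unitEnergyLimit))) := by
  -- Zero mass cannot be normalised; there the zero state has zero energy.
  rcases hρ.eq_or_lt with rfl | hρ
  · have h : ∀ᶠ L : ℝ in atTop,
        0 = dirichletEnergy (L • Q) β (0 * L ^ 2) / ENNReal.ofReal (L ^ 2) := by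
      filter_upwards [eventually_gt_atTop 0] with L hL
      rw [zero_mul, dirichletEnergy_zero (hQ.measurableSet hL), ENNReal.zero_div]
    simpa using tendsto_const_nhds.congr' h
  have hE : ∀ᶠ L : ℝ in atTop, ENNReal.ofReal (ρ * unitEnergy (β * ρ * L ^ 2) / L ^ 2)
      = dirichletEnergy (L • Q) β (ρ * L ^ 2) / ENNReal.ofReal (L ^ 2) := by
    filter_upwards [eventually_gt_atTop 0] with L hL
    rw [dirichletEnergy_eq hQ hL β hρ, ENNReal.ofReal_div_of_pos (by positivity)]
  refine Tendsto.congr' hE ((ENNReal.continuous_ofReal.tendsto _).comp ?_)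
  have hsq : Tendsto (fun L : ℝ => L ^ 2) atTop atTop := tendsto_pow_atTop two_ne_zero
  -- For `β = 0` the coupling does not grow; the energy is constant in `L` and vanishes after
  -- division by `L²`.
  rcases hβ.eq_or_lt with rfl | hβ
  · simpa using hsq.const_div_atTop (ρ * unitEnergy 0)
  · have h := (tendsto_unitEnergy_div.comp
      (hsq.const_mul_atTop (mul_pos hβ hρ))).const_mul (β * ρ ^ 2)
    refine h.congr' ?_
    filter_upwards [eventually_gt_atTop 0] with L hL
    simp only [Function.comp_apply]
    field_simp

end Square

end AnyonGas

theorem lemma3p4 :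
    ∃ e : ℝ → ℝ → ℝ,
      (∀ Q : Set AnyonGas.Plane, AnyonGas.IsUnitSquare Q →
        ∀ β ρ : ℝ, 0 ≤ β → 0 ≤ ρ →
          Tendsto (fun L : ℝ =>
              AnyonGas.dirichletEnergy (L • Q) β (ρ * L ^ 2) / ENNReal.ofReal (L ^ 2))
            atTop (𝓝 (ENNReal.ofReal (e β ρ)))) ∧
      (∀ β ρ : ℝ, 0 ≤ β → 0 ≤ ρ → 2 * Real.pi * β * ρ ^ 2 ≤ e β ρ) ∧
      2 * Real.pi ≤ e 1 1 := by
  refine ⟨fun β ρ => β * ρ ^ 2 * AnyonGas.unitEnergyLimit,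
    fun Q hQ β ρ hβ hρ => AnyonGas.tendsto_dirichletEnergy hQ hβ hρ, fun β ρ hβ hρ => ?_, ?_⟩
  · have := mul_le_mul_of_nonneg_left AnyonGas.two_pi_le_unitEnergyLimit
      (by positivity : 0 ≤ β * ρ ^ 2)
    linarith
  · simpa using AnyonGas.two_pi_le_unitEnergyLimit
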